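/- Let $\mu$ be a Borel probability measure on $\mathbb R$ with bounded support and $\int x\,d\mu(x)=0$, and suppose that $\mu$ has a density $\rho$ with respect to Lebesgue measure. Let $F(x)=\mu((-\infty,x])$ and let $Q(u)=\inf\{x : F(x)\ge u\}$, $u\in(0,1)$, be the quantile function of $\mu$. Let $q(\theta)=Q(|\theta|/\pi)$ for $0<|\theta|<\pi$, let $a_n=\frac1\pi\int_{-\pi}^{\pi}q(\theta)\cos(n\theta)\,d\theta$ be its Fourier coefficients, let $\Psi(z)=\sum_{n\ge1}a_nz^n$ on the unit disc $\mathbb D$, and let $G=\Psi(\mathbb D)$ (the Gross domain of $\mu$). The Skorokhod energy of $\mu$ is $$\Lambda(\mu)=\frac12\cdot\frac1{2\pi}\int_0^{2\pi}|h'(t)|^2\,dt\in[0,\infty],\qquad h(t)=\operatorname{Re}f(e^{it}),$$ where $f$ is any univalent map of $\mathbb D$ onto $G$ with $f(0)=0$, $f(e^{it})$ is its radial limit, and $h'$ is the distributional derivative of the $2\pi$-periodic function $h$; the energy is $+\infty$ if $h'\notin L^2$. Assume that the Fourier series of the almost everywhere derivative $q'$ of $q$ on $(-\pi,\pi)$ is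 obtained by termwise differentiation of the Fourier series of $q$, that is, it is $-\sum_{n\ge1}n\,a_n\sin(n\theta)$. Then $$\Lambda(\mu)=\frac1{2\pi^2}\int_0^1\frac{1}{\rho(Q(x))^2}\,dx,$$ as an equality in $[0,\infty]$ (both sides may be infinite). -/

import Mathlib

open MeasureTheory ProbabilityTheory Filter Topology
open scoped Real ENNReal ContDiff

noncomputable section

namespace Skorokhod

/-- The integrable function `g` is the distributional derivative of the `2π`-periodic function `f`,
tested over one period against smooth `2π`-periodic functions. -/
def IsDistribDeriv (f g : ℝ → ℝ) : Prop :=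
  IntervalIntegrable f volume 0 (2 * π) ∧
  IntervalIntegrable g volume 0 (2 * π) ∧
  ∀ φ : ℝ → ℝ, ContDiff ℝ ∞ φ → Function.Periodic φ (2 * π) →
    ∫ t in (0 : ℝ)..(2 * π), f t * deriv φ t = -∫ t in (0 : ℝ)..(2 * π), g t * φ t

/-- The kinetic energy `(1/2) (1/2π) ∫₀^{2π} |f'|²` of a `2π`-periodic function, `f'` being the
distributional derivative. That derivative is unique almost everywhere if it is a function, so the
infimum is over one value; it is `∞` if the distributional derivative is not a function. -/
def kineticEnergy (f : ℝ → ℝ) : ℝ≥0∞ :=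
  ⨅ (g : ℝ → ℝ) (_ : IsDistribDeriv f g),
    ENNReal.ofReal (1 / 2 * (1 / (2 * π))) *
      ∫⁻ t in Set.Ioo (0 : ℝ) (2 * π), ENNReal.ofReal (|g t| ^ 2)

/-- The radial limit `f(e^{iθ}) = lim_{r → 1⁻} f(r e^{iθ})`. For univalent `f` it exists for almost
every `θ`. -/
def radialLimit (f : ℂ → ℂ) (θ : ℝ) : ℂ :=
  limUnder (𝓝[<] (1 : ℝ)) fun r : ℝ => f ((r : ℂ) * Complex.exp ((θ : ℂ) * Complex.I))

/-- `f` maps the unit disc conformally (holomorphically and injectively) onto `U` and fixes `0`. -/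
def IsUnivalentOnto (f : ℂ → ℂ) (U : Set ℂ) : Prop :=
  DifferentiableOn ℂ f (Metric.ball 0 1) ∧ Set.InjOn f (Metric.ball 0 1) ∧
    f '' Metric.ball 0 1 = U ∧ f 0 = 0

/-- The Skorokhod energy of a domain `U` containing `0`: the kinetic energy of `θ ↦ Re f(e^{iθ})`
for a univalent map `f` of the unit disc onto `U` with `f(0) = 0`. Any two such maps differ by a
rotation of the disc, so the infimum is over one value. -/
def domainEnergy (U : Set ℂ) : ℝ≥0∞ :=
  ⨅ (f : ℂ → ℂ) (_ : IsUnivalentOnto f U), kineticEnergy fun θ => (radialLimit f θ).re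

/-- The quantile function `Q(u) = inf {x | F(x) ≥ u}` (used for `0 < u < 1`), where `F` is the
cumulative distribution function of `μ`. -/
def quantile (μ : Measure ℝ) (u : ℝ) : ℝ :=
  sInf {x : ℝ | u ≤ cdf μ x}

/-- The even function `θ ↦ Q(|θ|/π)` on `(-π, π)`. -/
def evenQuantile (μ : Measure ℝ) (θ : ℝ) : ℝ :=
  quantile μ (|θ| / π)

/-- The cosine Fourier coefficient `(1/π) ∫_{-π}^{π} f(θ) cos(nθ) dθ`. -/
def cosCoeff (f : ℝ → ℝ) (n : ℕ) : ℝ :=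
  1 / π * ∫ θ in (-π)..π, f θ * Real.cos (n * θ)

/-- The sine Fourier coefficient `(1/π) ∫_{-π}^{π} f(θ) sin(nθ) dθ`. -/
def sinCoeff (f : ℝ → ℝ) (n : ℕ) : ℝ :=
  1 / π * ∫ θ in (-π)..π, f θ * Real.sin (n * θ)

/-- The almost everywhere derivative `f'` of `f` is integrable on `(-π, π)`, and its Fourier series
is the termwise derivative `∑ (n bₙ cos(nθ) - n aₙ sin(nθ))` of the Fourier series
`a₀/2 + ∑ (aₙ cos(nθ) + bₙ sin(nθ))` of `f`. -/
def FourierTermwiseDeriv (f : ℝ → ℝ) : Prop :=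
  (∀ᵐ θ ∂volume.restrict (Set.Ioo (-π) π), DifferentiableAt ℝ f θ) ∧
  IntervalIntegrable f volume (-π) π ∧
  IntervalIntegrable (deriv f) volume (-π) π ∧
  ∀ n : ℕ, cosCoeff (deriv f) n = n * sinCoeff f n ∧ sinCoeff (deriv f) n = -(n * cosCoeff f n)

/-- The power series `Ψ(z) = ∑_{n ≥ 1} aₙ zⁿ`, where `aₙ` are the Fourier (cosine) coefficients of
`θ ↦ Q(|θ|/π)`. -/
def grossMap (μ : Measure ℝ) (z : ℂ) : ℂ :=
  ∑' n : ℕ, (cosCoeff (evenQuantile μ) (n + 1) : ℂ) * z ^ (n + 1)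

/-- The Gross domain generated by `μ`. -/
def grossDomain (μ : Measure ℝ) : Set ℂ :=
  grossMap μ '' Metric.ball 0 1

/-- The Skorokhod energy `Λ(μ)` of the distribution `μ`. -/
def distributionEnergy (μ : Measure ℝ) : ℝ≥0∞ :=
  domainEnergy (grossDomain μ)

end Skorokhod

end

/-!
Write `q(θ) = Q(|θ|/π)` and `Ψ` for the Gross map. Termwise differentiation says that the power
series coefficients `aₙ` of `Ψ` are `-bₙ/n`, where `bₙ` are the sine coefficients of the odd
integrable function `q'`; hence `Ψ(z) = -(i/π) ∫ q'(t) log(1 - z e^{it}) dt`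
(`hasSum_cosCoeff_mul_pow`). This representation gives everything.

* `Ψ` is univalent (`isUnivalentOnto_grossMap`). Folding the integral onto `(0, π)`, where `q' > 0`
  almost everywhere, writes `z Ψ'(z)` as a negative average of the functions
  `z / (1 - 2 z cos t + z²)`, so that `Im (z Ψ'(z)) < 0` in the upper half-disc. In the variable
  `log z` this is a derivative with negative imaginary part on a convex half-strip, which forces
  injectivity there (`injOn_ball_of_im_mul_deriv_neg`).
* By the Schwarz lemma every univalent map of the disc onto the Gross domain fixing `0` is a
  rotation of `Ψ` (`IsUnivalentOnto.exists_rotation`), so only rotations have to be considered.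
* The logarithmic singularity is integrable, so for almost every `β` dominated convergence yields
  the radial limit of `Ψ` at `e^{iβ}` (`tendsto_logPotential`). Its real part is, as `q'` is odd,
  minus the convolution of `q'` with the sawtooth `arg (1 - e^{iu}) / π`, whose distributional
  derivative is a constant minus a point mass at each jump. As `q'` has mean zero, the boundary
  function has the distributional derivative `q'`, rotated accordingly
  (`isDistribDeriv_boundary`), and this derivative is unique (`IsDistribDeriv.ae_eq`). Therefore
  the energy is `1/(4π)` times the integral of `|q'|²` over `(-π, π)`.
* The quantile function `Q` carries Lebesgue measure on `(0, 1)` to `μ`, and the distribution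
  function has derivative `ρ` almost everywhere; differentiating `F(q(θ)) = θ/π` gives
  `q'(θ) = 1 / (π ρ(q(θ)))` (`ae_density_mul_deriv_evenQuantile`), which is the formula after the
  substitution `θ = π u`, and also the positivity of `q'` used for univalence.
-/

noncomputable section

namespace Skorokhod

/-! ### Univalent maps of the disc and the Noshiro–Warschawski argument -/

/-- The open mapping theorem in filter form: an injective map is not locally constant. -/
lemma map_nhds_eq_of_injOn {f : ℂ → ℂ} {U : Set ℂ} (hU : IsOpen U) (hf : DifferentiableOn ℂ f U)
    (hinj : Set.InjOn f U) {z : ℂ} (hz : z ∈ U) : map f (𝓝 z) = 𝓝 (f z) := by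
  have han : AnalyticAt ℂ f z := hf.analyticAt (hU.mem_nhds hz)
  refine le_antisymm han.continuousAt ?_
  refine (han.eventually_constant_or_nhds_le_map_nhds).resolve_left fun hc => ?_
  have h1 : ∀ᶠ w in 𝓝[≠] z, w = z := by
    filter_upwards [hc.filter_mono nhdsWithin_le_nhds,
      mem_nhdsWithin_of_mem_nhds (hU.mem_nhds hz)] with w h1 h2
    exact hinj h2 hz h1
  obtain ⟨w, h1, h2⟩ := (h1.and self_mem_nhdsWithin).exists
  exact h2 h1

lemma continuousAt_invFunOn {f : ℂ → ℂ} {U : Set ℂ} (hU : IsOpen U) (hf : DifferentiableOn ℂ f U)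
    (hinj : Set.InjOn f U) {z : ℂ} (hz : z ∈ U) :
    ContinuousAt (Function.invFunOn f U) (f z) := by
  have hl : ∀ w ∈ U, Function.invFunOn f U (f w) = w := fun w hw => hinj.leftInvOn_invFunOn hw
  rw [ContinuousAt, hl z hz, ← map_nhds_eq_of_injOn hU hf hinj hz, tendsto_map'_iff]
  refine tendsto_id.congr' ?_
  filter_upwards [hU.mem_nhds hz] with w hw
  exact (hl w hw).symm

lemma differentiableAt_invFunOn {f : ℂ → ℂ} {U : Set ℂ} (hU : IsOpen U)
    (hf : DifferentiableOn ℂ f U) (hinj : Set.InjOn f U) {z : ℂ} (hz : z ∈ U)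
    (h0 : deriv f z ≠ 0) : DifferentiableAt ℂ (Function.invFunOn f U) (f z) := by
  have hl : ∀ w ∈ U, Function.invFunOn f U (f w) = w := fun w hw => hinj.leftInvOn_invFunOn hw
  have hd : HasDerivAt f (deriv f z) (Function.invFunOn f U (f z)) := by
    rw [hl z hz]
    exact (hf.differentiableAt (hU.mem_nhds hz)).hasDerivAt
  refine (HasDerivAt.of_local_left_inverse (continuousAt_invFunOn hU hf hinj hz) hd h0
    ?_).differentiableAt
  rw [← map_nhds_eq_of_injOn hU hf hinj hz, eventually_map]
  filter_upwards [hU.mem_nhds hz] with w hw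
  rw [hl w hw]

/-- The inverse is continuous by the open mapping theorem and differentiable away from the isolated
zeros of `f'`, so by removability it is differentiable at the image of such a zero as well, and the
chain rule excludes the zero. -/
lemma deriv_ne_zero_of_injOn {f : ℂ → ℂ} {U : Set ℂ} (hU : IsOpen U)
    (hf : DifferentiableOn ℂ f U) (hinj : Set.InjOn f U) {z : ℂ} (hz : z ∈ U) :
    deriv f z ≠ 0 := by
  have hl : ∀ w ∈ U, Function.invFunOn f U (f w) = w := fun w hw => hinj.leftInvOn_invFunOn hw
  have han : AnalyticAt ℂ f z := hf.analyticAt (hU.mem_nhds hz)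
  have hev : ∀ᶠ w in 𝓝[≠] z, deriv f w ≠ 0 := by
    refine han.deriv.eventually_eq_zero_or_eventually_ne_zero.resolve_left fun hc => ?_
    obtain ⟨r, hr, hball⟩ := Metric.mem_nhds_iff.1 (hc.and (hU.mem_nhds hz))
    have hconst : ∀ w ∈ Metric.ball z r, f w = f z := fun w hw =>
      Metric.isOpen_ball.is_const_of_deriv_eq_zero (convex_ball z r).isPreconnected
        (hf.mono fun y hy => (hball hy).2) (fun y hy => (hball hy).1) hw
        (Metric.mem_ball_self hr)
    have hw : z + (r / 2 : ℝ) ∈ Metric.ball z r := by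
      simp only [Metric.mem_ball, dist_self_add_left, Complex.norm_real, Real.norm_eq_abs]
      rw [abs_of_pos (by positivity)]
      linarith
    have := hinj (hball hw).2 hz (hconst _ hw)
    simp only [add_eq_left, Complex.ofReal_eq_zero] at this
    linarith
  have hdi : ∀ᶠ y in 𝓝[≠] (f z), DifferentiableAt ℂ (Function.invFunOn f U) y := by
    rw [eventually_nhdsWithin_iff, ← map_nhds_eq_of_injOn hU hf hinj hz, eventually_map]
    filter_upwards [hU.mem_nhds hz, eventually_nhdsWithin_iff.1 hev] with w hw h2 h3
    exact differentiableAt_invFunOn hU hf hinj hw (h2 fun h => h3 (by rw [h]; rfl))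
  have hda : DifferentiableAt ℂ (Function.invFunOn f U) (f z) :=
    (Complex.analyticAt_of_differentiable_on_punctured_nhds_of_continuousAt hdi
      (continuousAt_invFunOn hU hf hinj hz)).differentiableAt
  intro h0
  have hcomp := hda.hasDerivAt.comp z han.differentiableAt.hasDerivAt
  have hid : HasDerivAt (Function.invFunOn f U ∘ f) 1 z := by
    refine (hasDerivAt_id z).congr_of_eventuallyEq ?_
    filter_upwards [hU.mem_nhds hz] with w hw
    exact hl w hw
  have := hcomp.unique hid
  rw [h0, mul_zero] at this
  exact zero_ne_one this

/-- The conformal map `f⁻¹ ∘ g` of the disc, for univalent maps `f`, `g` with the same image,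
does not increase the modulus. Applied in both directions it gives `‖f⁻¹(g(z))‖ = ‖z‖`. -/
lemma IsUnivalentOnto.schwarz {f g : ℂ → ℂ} {U : Set ℂ} (hf : IsUnivalentOnto f U)
    (hg : IsUnivalentOnto g U) :
    DifferentiableOn ℂ (Function.invFunOn f (Metric.ball 0 1) ∘ g) (Metric.ball 0 1) ∧
    Set.MapsTo (Function.invFunOn f (Metric.ball 0 1) ∘ g) (Metric.ball 0 1) (Metric.ball 0 1) ∧
    (∀ z ∈ Metric.ball (0 : ℂ) 1, f (Function.invFunOn f (Metric.ball 0 1) (g z)) = g z) ∧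
    Function.invFunOn f (Metric.ball 0 1) (g 0) = 0 ∧
    ∀ z ∈ Metric.ball (0 : ℂ) 1, ‖Function.invFunOn f (Metric.ball 0 1) (g z)‖ ≤ ‖z‖ := by
  obtain ⟨hfd, hfi, hfU, hf0⟩ := hf
  obtain ⟨hgd, hgi, hgU, hg0⟩ := hg
  have hmem : ∀ z ∈ Metric.ball (0 : ℂ) 1, g z ∈ f '' Metric.ball 0 1 := fun z hz => by
    rw [hfU, ← hgU]
    exact Set.mem_image_of_mem g hz
  have hmaps : Set.MapsTo (Function.invFunOn f (Metric.ball 0 1) ∘ g) (Metric.ball 0 1)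
      (Metric.ball 0 1) := fun z hz => Function.invFunOn_mem (hmem z hz)
  have heq : ∀ z ∈ Metric.ball (0 : ℂ) 1, f (Function.invFunOn f (Metric.ball 0 1) (g z)) = g z :=
    fun z hz => Function.invFunOn_eq (hmem z hz)
  have h0 : Function.invFunOn f (Metric.ball 0 1) (g 0) = 0 := by
    rw [hg0]
    exact (congrArg _ hf0.symm).trans (hfi.leftInvOn_invFunOn (Metric.mem_ball_self one_pos))
  have hdiff : DifferentiableOn ℂ (Function.invFunOn f (Metric.ball 0 1) ∘ g)
      (Metric.ball 0 1) := fun z hz => by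
    obtain ⟨w, hw, hwz⟩ := hmem z hz
    refine (DifferentiableAt.comp z ?_
      (hgd.differentiableAt (Metric.isOpen_ball.mem_nhds hz))).differentiableWithinAt
    rw [← hwz]
    exact differentiableAt_invFunOn Metric.isOpen_ball hfd hfi hw
      (deriv_ne_zero_of_injOn Metric.isOpen_ball hfd hfi hw)
  refine ⟨hdiff, hmaps, heq, h0, fun z hz => ?_⟩
  exact Complex.norm_le_norm_of_mapsTo_ball hdiff
    (hmaps.mono_right Metric.ball_subset_closedBall) h0 (by simpa using hz)

/-- Two univalent maps of the disc onto the same domain that fix `0` differ by a rotation. -/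
lemma IsUnivalentOnto.exists_rotation {f g : ℂ → ℂ} {U : Set ℂ} (hf : IsUnivalentOnto f U)
    (hg : IsUnivalentOnto g U) :
    ∃ α : ℝ, ∀ z ∈ Metric.ball (0 : ℂ) 1, g z = f (z * Complex.exp (α * Complex.I)) := by
  obtain ⟨hd, hm, heq, h0, hle⟩ := hf.schwarz hg
  obtain ⟨-, hm', heq', -, hle'⟩ := hg.schwarz hf
  -- `k = f⁻¹ ∘ g` and its inverse both shrink moduli, so `k` attains equality in Schwarz's lemma.
  set k := Function.invFunOn f (Metric.ball 0 1) ∘ g with hk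
  have hhalf : (1 / 2 : ℂ) ∈ Metric.ball (0 : ℂ) 1 := by norm_num [Metric.mem_ball]
  have hnorm : ‖k (1 / 2)‖ = ‖(1 / 2 : ℂ)‖ := by
    refine le_antisymm (hle _ hhalf) ?_
    have hkm := hm hhalf
    have h1 := hle' _ hkm
    have h2 : Function.invFunOn g (Metric.ball 0 1) (f (k (1 / 2))) = 1 / 2 := by
      have : f (k (1 / 2)) = g (1 / 2) := heq _ hhalf
      rw [this]
      exact hg.2.1.leftInvOn_invFunOn hhalf
    rwa [h2] at h1
  have hk0 : k 0 = 0 := h0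
  have hds : ‖dslope k 0 (1 / 2)‖ = 1 := by
    rw [dslope_of_ne _ (by norm_num), slope_def_field, hk0]
    simp only [sub_zero, norm_div, hnorm]
    norm_num
  have haff := Complex.affine_of_mapsTo_ball_of_norm_dslope_eq_div (f := k) (c := 0) (R₁ := 1)
    (R₂ := 1) (z₀ := 1 / 2) hd (by
      rw [hk0]
      exact hm.mono_right Metric.ball_subset_closedBall) hhalf (by rw [hds]; norm_num)
  refine ⟨Complex.arg (dslope k 0 (1 / 2)), fun z hz => ?_⟩
  have h3 := haff hz
  have h4 : Complex.exp (Complex.arg (dslope k 0 (1 / 2)) * Complex.I) = dslope k 0 (1 / 2) := by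
    have := Complex.norm_mul_exp_arg_mul_I (dslope k 0 (1 / 2))
    rwa [hds, Complex.ofReal_one, one_mul] at this
  rw [h4, ← heq z hz]
  change f (k z) = _
  rw [h3, hk0]
  simp

/-- The Noshiro–Warschawski argument: along the segment from `a` to `b` the imaginary part of
`f / (b - a)` is strictly decreasing, so `f` separates the endpoints. -/
lemma im_sub_div_neg_of_im_deriv_neg {f f' : ℂ → ℂ} {S : Set ℂ} (hS : Convex ℝ S)
    (hf : ∀ z ∈ S, HasDerivAt f (f' z) z) (hneg : ∀ z ∈ S, (f' z).im < 0) {a b : ℂ}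
    (ha : a ∈ S) (hb : b ∈ S) (hab : a ≠ b) : ((f b - f a) / (b - a)).im < 0 := by
  have hba : b - a ≠ 0 := sub_ne_zero.2 hab.symm
  have hmem : ∀ s ∈ Set.Icc (0 : ℝ) 1, a + s * (b - a) ∈ S := fun s hs => by
    have := hS.add_smul_sub_mem ha hb hs
    simpa using this
  have hd : ∀ s ∈ Set.Icc (0 : ℝ) 1,
      HasDerivAt (fun s : ℝ => (f (a + s * (b - a)) / (b - a)).im) (f' (a + s * (b - a))).im s := by
    intro s hs
    have h1 : HasDerivAt (fun s : ℝ => a + (s : ℂ) * (b - a)) (b - a) s := by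
      have h := (((hasDerivAt_id s).ofReal_comp).mul_const (b - a)).const_add a
      rw [Complex.ofReal_one, one_mul] at h
      exact h
    have h2 := ((hf _ (hmem s hs)).comp s h1).div_const (b - a)
    have h3 : HasDerivAt (fun s : ℝ => f (a + s * (b - a)) / (b - a)) (f' (a + s * (b - a))) s := by
      rwa [mul_div_cancel_right₀ _ hba] at h2
    exact (Complex.imCLM.hasFDerivAt.comp_hasDerivAt s h3)
  have hanti : StrictAntiOn (fun s : ℝ => (f (a + s * (b - a)) / (b - a)).im) (Set.Icc 0 1) := by
    refine strictAntiOn_of_deriv_neg (convex_Icc 0 1)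
      (fun s hs => (hd s hs).continuousAt.continuousWithinAt) fun s hs => ?_
    rw [interior_Icc] at hs
    rw [(hd s (Set.Ioo_subset_Icc_self hs)).deriv]
    exact hneg _ (hmem s (Set.Ioo_subset_Icc_self hs))
  have := hanti (Set.left_mem_Icc.2 zero_le_one) (Set.right_mem_Icc.2 zero_le_one) zero_lt_one
  simp only [Complex.ofReal_zero, zero_mul, add_zero, Complex.ofReal_one, one_mul,
    add_sub_cancel] at this
  rw [sub_div, Complex.sub_im]
  linarith

/-! ### A univalence criterion and the logarithmic potential -/

/-- `Im Ψ` decreases from `0` along each ray into the upper half-disc. -/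
lemma im_neg_of_im_mul_deriv_neg {Ψ d : ℂ → ℂ}
    (hd : ∀ z ∈ Metric.ball (0 : ℂ) 1, HasDerivAt Ψ (d z) z) (h0 : Ψ 0 = 0)
    (him : ∀ z ∈ Metric.ball (0 : ℂ) 1, 0 < z.im → (z * d z).im < 0)
    {z : ℂ} (hz : z ∈ Metric.ball (0 : ℂ) 1) (hz0 : 0 < z.im) : (Ψ z).im < 0 := by
  have hmem : ∀ s ∈ Set.Icc (0 : ℝ) 1, (s : ℂ) * z ∈ Metric.ball (0 : ℂ) 1 := fun s hs => by
    simp only [mem_ball_zero_iff, norm_mul, Complex.norm_real, Real.norm_eq_abs,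
      abs_of_nonneg hs.1] at hz ⊢
    nlinarith [norm_nonneg z, hs.2]
  have hder : ∀ s ∈ Set.Icc (0 : ℝ) 1,
      HasDerivAt (fun s : ℝ => (Ψ (s * z)).im) (d (s * z) * z).im s := by
    intro s hs
    have h1 : HasDerivAt (fun s : ℝ => (s : ℂ) * z) z s := by
      have h := ((hasDerivAt_id s).ofReal_comp).mul_const z
      rwa [Complex.ofReal_one, one_mul] at h
    exact Complex.imCLM.hasFDerivAt.comp_hasDerivAt s ((hd _ (hmem s hs)).comp s h1)
  have hanti : StrictAntiOn (fun s : ℝ => (Ψ (s * z)).im) (Set.Icc 0 1) := by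
    refine strictAntiOn_of_deriv_neg (convex_Icc 0 1)
      (fun s hs => (hder s hs).continuousAt.continuousWithinAt) fun s hs => ?_
    rw [interior_Icc] at hs
    rw [(hder s (Set.Ioo_subset_Icc_self hs)).deriv]
    have h2 := him _ (hmem s (Set.Ioo_subset_Icc_self hs)) (by
      rw [Complex.im_ofReal_mul]
      exact mul_pos hs.1 hz0)
    rw [mul_assoc, Complex.im_ofReal_mul, mul_comm z] at h2
    by_contra hcon
    exact absurd h2 (not_lt.2 (mul_nonneg hs.1.le (not_lt.1 hcon)))
  have := hanti (Set.left_mem_Icc.2 zero_le_one) (Set.right_mem_Icc.2 zero_le_one) zero_lt_one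
  simpa [h0] using this

/-- A real-symmetric `Ψ` with `Im (z Ψ'(z)) < 0` on the upper half of the disc is univalent there:
in the variable `w = log z`, which ranges over a convex half-strip, the derivative of `Ψ (exp w)`
is `z Ψ'(z)`, so the Noshiro–Warschawski argument applies. The sign of `Im Ψ` separates the upper
half-disc, the lower one and the real axis, where `Ψ` is monotone. -/
lemma injOn_ball_of_im_mul_deriv_neg {Ψ d : ℂ → ℂ}
    (hd : ∀ z ∈ Metric.ball (0 : ℂ) 1, HasDerivAt Ψ (d z) z) (h0 : Ψ 0 = 0)
    (hconj : ∀ z ∈ Metric.ball (0 : ℂ) 1, Ψ (starRingEnd ℂ z) = starRingEnd ℂ (Ψ z))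
    (him : ∀ z ∈ Metric.ball (0 : ℂ) 1, 0 < z.im → (z * d z).im < 0)
    (hre : ∀ x : ℝ, (x : ℂ) ∈ Metric.ball (0 : ℂ) 1 → (d x).re < 0) :
    Set.InjOn Ψ (Metric.ball 0 1) := by
  have hcmem : ∀ z ∈ Metric.ball (0 : ℂ) 1, starRingEnd ℂ z ∈ Metric.ball (0 : ℂ) 1 := by
    intro z hz
    simpa using hz
  have hup : ∀ z ∈ Metric.ball (0 : ℂ) 1, 0 < z.im → (Ψ z).im < 0 := fun z hz hz0 =>
    im_neg_of_im_mul_deriv_neg hd h0 him hz hz0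
  have hlow : ∀ z ∈ Metric.ball (0 : ℂ) 1, z.im < 0 → 0 < (Ψ z).im := fun z hz hz0 => by
    have := hup _ (hcmem z hz) (by simpa using hz0)
    rw [hconj z hz, Complex.conj_im] at this
    linarith
  have hreal : ∀ z ∈ Metric.ball (0 : ℂ) 1, z.im = 0 → (Ψ z).im = 0 := fun z hz hz0 => by
    rw [← Complex.conj_eq_iff_im, ← hconj z hz, Complex.conj_eq_iff_im.2 hz0]
  have hinj_up : ∀ z ∈ Metric.ball (0 : ℂ) 1, ∀ w ∈ Metric.ball (0 : ℂ) 1, 0 < z.im → 0 < w.im →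
      Ψ z = Ψ w → z = w := by
    intro z hz w hw hz0 hw0 hzw
    set S : Set ℂ := {w | w.re < 0 ∧ 0 < w.im ∧ w.im < π} with hSdef
    have hS : Convex ℝ S :=
      (convex_halfSpace_re_lt 0).inter ((convex_halfSpace_im_gt 0).inter (convex_halfSpace_im_lt π))
    have hne : ∀ z : ℂ, 0 < z.im → z ≠ 0 := fun z hz h => by simp [h] at hz
    have hlog : ∀ z ∈ Metric.ball (0 : ℂ) 1, 0 < z.im → Complex.log z ∈ S := by
      intro z hz hz0
      refine ⟨?_, ?_, ?_⟩
      · rw [Complex.log_re]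
        exact Real.log_neg (norm_pos_iff.2 (hne z hz0)) (by simpa using hz)
      · rw [Complex.log_im]
        refine lt_of_le_of_ne (Complex.arg_nonneg_iff.2 hz0.le) fun h => ?_
        exact hz0.ne' (Complex.arg_eq_zero_iff.1 h.symm).2
      · rw [Complex.log_im]
        refine lt_of_le_of_ne (Complex.arg_le_pi z) fun h => ?_
        exact hz0.ne' (Complex.arg_eq_pi_iff.1 h).2
    have hexp : ∀ w ∈ S, Complex.exp w ∈ Metric.ball (0 : ℂ) 1 ∧ 0 < (Complex.exp w).im := by
      intro w hw
      refine ⟨by simpa [Complex.norm_exp] using hw.1, ?_⟩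
      rw [Complex.exp_im]
      exact mul_pos (Real.exp_pos _) (Real.sin_pos_of_pos_of_lt_pi hw.2.1 hw.2.2)
    by_contra hcon
    have hlne : Complex.log z ≠ Complex.log w := fun h => hcon (by
      rw [← Complex.exp_log (hne z hz0), h, Complex.exp_log (hne w hw0)])
    have := im_sub_div_neg_of_im_deriv_neg (f := fun w => Ψ (Complex.exp w))
      (f' := fun w => d (Complex.exp w) * Complex.exp w) hS
      (fun v hv => (hd _ (hexp v hv).1).comp v (Complex.hasDerivAt_exp v))
      (fun v hv => by
        rw [mul_comm]
        exact him _ (hexp v hv).1 (hexp v hv).2)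
      (hlog z hz hz0) (hlog w hw hw0) hlne
    rw [Complex.exp_log (hne z hz0), Complex.exp_log (hne w hw0), hzw, sub_self, zero_div] at this
    exact lt_irrefl _ this
  intro z hz w hw hzw
  rcases lt_trichotomy z.im 0 with hz0 | hz0 | hz0 <;>
    rcases lt_trichotomy w.im 0 with hw0 | hw0 | hw0
  · have := hinj_up _ (hcmem z hz) _ (hcmem w hw) (by simpa using hz0) (by simpa using hw0)
      (by rw [hconj z hz, hconj w hw, hzw])
    exact (starRingEnd ℂ).injective this
  · have h1 := hlow z hz hz0
    rw [hzw, hreal w hw hw0] at h1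
    exact absurd h1 (lt_irrefl _)
  · have h1 := hlow z hz hz0
    rw [hzw] at h1
    exact absurd h1 (hup w hw hw0).not_gt
  · have h1 := hlow w hw hw0
    rw [← hzw, hreal z hz hz0] at h1
    exact absurd h1 (lt_irrefl _)
  · have hmem : ∀ x ∈ Set.Ioo (-1 : ℝ) 1, (x : ℂ) ∈ Metric.ball (0 : ℂ) 1 := fun x hx => by
      simpa [abs_lt] using hx
    have hder : ∀ x ∈ Set.Ioo (-1 : ℝ) 1, HasDerivAt (fun x : ℝ => (Ψ x).re) (d x).re x :=
      fun x hx => (hd _ (hmem x hx)).real_of_complex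
    have hanti : StrictAntiOn (fun x : ℝ => (Ψ x).re) (Set.Ioo (-1) 1) := by
      refine strictAntiOn_of_deriv_neg (convex_Ioo _ _)
        (fun s hs => (hder s hs).continuousAt.continuousWithinAt) fun s hs => ?_
      rw [interior_Ioo] at hs
      rw [(hder s hs).deriv]
      exact hre s (hmem s hs)
    have hzr : z = (z.re : ℂ) := Complex.ext rfl (by simpa using hz0)
    have hwr : w = (w.re : ℂ) := Complex.ext rfl (by simpa using hw0)
    have habs : ∀ z ∈ Metric.ball (0 : ℂ) 1, z.re ∈ Set.Ioo (-1 : ℝ) 1 := fun z hz =>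
      abs_lt.1 ((Complex.abs_re_le_norm z).trans_lt (by simpa using hz))
    have := hanti.injOn (habs z hz) (habs w hw) (by
      rw [← hzr, ← hwr, hzw])
    rw [hzr, hwr, this]
  · have h1 := hup w hw hw0
    rw [← hzw, hreal z hz hz0] at h1
    exact absurd h1 (lt_irrefl _)
  · have h1 := hlow w hw hw0
    rw [← hzw] at h1
    exact absurd h1 (hup z hz hz0).not_gt
  · have h1 := hup z hz hz0
    rw [hzw, hreal w hw hw0] at h1
    exact absurd h1 (lt_irrefl _)
  · exact hinj_up z hz w hw hz0 hw0 hzw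

/-- The analytic function `-(i/π) ∫ p(t) log(1 - z e^{it}) dt` on the unit disc. For odd `p` it is
the power series whose coefficients are `-bₙ / n`, where `bₙ` are the sine coefficients of `p`. -/
def logPotential (p : ℝ → ℝ) (z : ℂ) : ℂ :=
  -(Complex.I / π) * ∫ t in (-π)..π, (p t : ℂ) * Complex.log (1 - z * Complex.exp (t * Complex.I))

lemma norm_mul_exp_ofReal_mul_I (z : ℂ) (t : ℝ) : ‖z * Complex.exp (t * Complex.I)‖ = ‖z‖ := by
  rw [norm_mul, Complex.norm_exp_ofReal_mul_I, mul_one]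

lemma one_sub_mem_slitPlane {z : ℂ} (hz : ‖z‖ < 1) : 1 - z ∈ Complex.slitPlane := by
  refine Or.inl ?_
  have := (Complex.re_le_norm z).trans_lt hz
  simp only [Complex.sub_re, Complex.one_re]
  linarith

lemma continuous_log_one_sub_mul_exp {z : ℂ} (hz : ‖z‖ < 1) :
    Continuous fun t : ℝ => Complex.log (1 - z * Complex.exp (t * Complex.I)) :=
  Continuous.clog (by fun_prop) fun t =>
    one_sub_mem_slitPlane (by rwa [norm_mul_exp_ofReal_mul_I])

lemma _root_.IntervalIntegrable.ofReal_mul_continuous {p : ℝ → ℝ} {a b : ℝ}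
    (hp : IntervalIntegrable p volume a b) {g : ℝ → ℂ} (hg : Continuous g) :
    IntervalIntegrable (fun t => (p t : ℂ) * g t) volume a b := by
  have h1 : IntervalIntegrable (fun t => (p t : ℂ)) volume a b :=
    ⟨hp.1.ofReal, hp.2.ofReal⟩
  exact h1.mul_continuousOn hg.continuousOn

/-- Folding the integral against an odd function onto `(0, π)`. -/
lemma integral_odd_mul {p : ℝ → ℝ} (hp : IntervalIntegrable p volume (-π) π)
    (hodd : ∀ t, p (-t) = -p t) {g : ℝ → ℂ} (hg : Continuous g) :
    ∫ t in (-π)..π, (p t : ℂ) * g t = ∫ t in (0 : ℝ)..π, (p t : ℂ) * (g t - g (-t)) := by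
  have hi : IntervalIntegrable (fun t => (p t : ℂ) * g t) volume (-π) π :=
    hp.ofReal_mul_continuous hg
  have hpi := Real.pi_pos
  have h1 : IntervalIntegrable (fun t => (p t : ℂ) * g t) volume (-π) 0 :=
    hi.mono_set (by
      rw [Set.uIcc_of_le (by linarith), Set.uIcc_of_le (by linarith)]
      exact Set.Icc_subset_Icc_right hpi.le)
  have hsub : Set.uIcc 0 π ⊆ Set.uIcc (-π) π := by
    rw [Set.uIcc_of_le (by linarith), Set.uIcc_of_le (by linarith)]
    exact Set.Icc_subset_Icc_left (by linarith)
  have h2 : IntervalIntegrable (fun t => (p t : ℂ) * g t) volume 0 π := hi.mono_set hsub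
  have h3 : IntervalIntegrable (fun t => (p t : ℂ) * g (-t)) volume 0 π :=
    (hp.mono_set hsub).ofReal_mul_continuous (hg.comp continuous_neg)
  rw [← intervalIntegral.integral_add_adjacent_intervals h1 h2]
  have h4 : ∫ t in (-π)..0, (p t : ℂ) * g t = -∫ t in (0 : ℝ)..π, (p t : ℂ) * g (-t) := by
    have := intervalIntegral.integral_comp_neg (a := 0) (b := π) fun t => (p t : ℂ) * g t
    rw [neg_zero] at this
    rw [← this, ← intervalIntegral.integral_neg]
    refine intervalIntegral.integral_congr fun t _ => ?_
    simp only [hodd]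
    push_cast
    ring
  rw [h4, add_comm, ← sub_eq_add_neg, ← intervalIntegral.integral_sub h2 h3]
  refine intervalIntegral.integral_congr fun t _ => ?_
  ring

lemma one_sub_two_mul_cos_add_sq (z : ℂ) (t : ℝ) :
    1 - 2 * z * (Real.cos t : ℂ) + z ^ 2 =
      (1 - z * Complex.exp (t * Complex.I)) * (1 - z * Complex.exp (-t * Complex.I)) := by
  have h : Complex.exp (t * Complex.I) * Complex.exp (-t * Complex.I) = 1 := by
    rw [← Complex.exp_add]
    simp
  have hc : 2 * (Real.cos t : ℂ) = Complex.exp (t * Complex.I) + Complex.exp (-t * Complex.I) := by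
    rw [Complex.ofReal_cos, Complex.two_cos]
  linear_combination (-z) * hc - z ^ 2 * h

lemma one_sub_two_mul_cos_add_sq_ne_zero {z : ℂ} (hz : ‖z‖ < 1) (t : ℝ) :
    1 - 2 * z * (Real.cos t : ℂ) + z ^ 2 ≠ 0 := by
  rw [one_sub_two_mul_cos_add_sq]
  refine mul_ne_zero (Complex.slitPlane_ne_zero (one_sub_mem_slitPlane ?_))
    (Complex.slitPlane_ne_zero (one_sub_mem_slitPlane ?_))
  · rwa [norm_mul_exp_ofReal_mul_I]
  · rw [← Complex.ofReal_neg, norm_mul_exp_ofReal_mul_I]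
    exact hz

/-- Differentiation under the integral sign, folded onto `(0, π)`. -/
lemma hasDerivAt_logPotential {p : ℝ → ℝ} (hp : IntervalIntegrable p volume (-π) π)
    (hodd : ∀ t, p (-t) = -p t) {z : ℂ} (hz : ‖z‖ < 1) :
    HasDerivAt (logPotential p) (-(2 / π) * ∫ t in (0 : ℝ)..π,
      (p t : ℂ) * ((Real.sin t : ℂ) / (1 - 2 * z * (Real.cos t : ℂ) + z ^ 2))) z := by
  obtain ⟨r, hzr, hr⟩ := exists_between hz
  have hne : ∀ w : ℂ, ‖w‖ < 1 → ∀ t : ℝ, 1 - w * Complex.exp (t * Complex.I) ≠ 0 := fun w hw t =>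
    Complex.slitPlane_ne_zero (one_sub_mem_slitPlane (by rwa [norm_mul_exp_ofReal_mul_I]))
  have hcont : ∀ w : ℂ, ‖w‖ < 1 → Continuous fun t : ℝ =>
      -Complex.exp (t * Complex.I) / (1 - w * Complex.exp (t * Complex.I)) := fun w hw =>
    Continuous.div (by fun_prop) (by fun_prop) (hne w hw)
  have key := intervalIntegral.hasDerivAt_integral_of_dominated_loc_of_deriv_le
    (μ := volume) (a := -π) (b := π) (x₀ := z) (s := Metric.ball 0 r)
    (bound := fun t => |p t| * (1 / (1 - r)))
    (F := fun w t => (p t : ℂ) * Complex.log (1 - w * Complex.exp (t * Complex.I)))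
    (F' := fun w t => (p t : ℂ) *
      (-Complex.exp (t * Complex.I) / (1 - w * Complex.exp (t * Complex.I))))
    (Metric.isOpen_ball.mem_nhds (by simpa using hzr))
    (by
      filter_upwards [Metric.isOpen_ball.mem_nhds (show z ∈ Metric.ball (0 : ℂ) 1 by simpa using hz)]
        with w hw
      exact (hp.ofReal_mul_continuous (continuous_log_one_sub_mul_exp
        (by simpa using hw))).aestronglyMeasurable_restrict_uIoc)
    (hp.ofReal_mul_continuous (continuous_log_one_sub_mul_exp hz))
    ((hp.ofReal_mul_continuous (hcont z hz)).aestronglyMeasurable_restrict_uIoc)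
    (by
      refine Eventually.of_forall fun t _ w hw => ?_
      rw [mem_ball_zero_iff] at hw
      rw [norm_mul, Complex.norm_real, Real.norm_eq_abs, norm_div, norm_neg,
        Complex.norm_exp_ofReal_mul_I]
      have h1 : 1 - r ≤ ‖1 - w * Complex.exp (t * Complex.I)‖ := by
        have := norm_sub_norm_le 1 (w * Complex.exp (t * Complex.I))
        rw [norm_mul_exp_ofReal_mul_I, norm_one] at this
        linarith
      have h2 : 0 < 1 - r := by linarith
      gcongr)
    (hp.abs.mul_const _)
    (by
      refine Eventually.of_forall fun t _ w hw => ?_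
      rw [mem_ball_zero_iff] at hw
      have h1 : HasDerivAt (fun w : ℂ => 1 - w * Complex.exp (t * Complex.I))
          (-Complex.exp (t * Complex.I)) w := by
        have h := ((hasDerivAt_id w).mul_const (Complex.exp (t * Complex.I))).const_sub 1
        rwa [one_mul] at h
      exact (h1.clog (one_sub_mem_slitPlane
        (by rw [norm_mul_exp_ofReal_mul_I]; linarith))).const_mul _)
  have h := key.2.const_mul (-(Complex.I / π))
  rw [integral_odd_mul hp hodd (hcont z hz)] at h
  refine HasDerivAt.congr_deriv (f := logPotential p) h ?_
  rw [← intervalIntegral.integral_const_mul, ← intervalIntegral.integral_const_mul]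
  refine intervalIntegral.integral_congr fun t _ => ?_
  have hs : 2 * (Real.sin t : ℂ) =
      (Complex.exp (-t * Complex.I) - Complex.exp (t * Complex.I)) * Complex.I := by
    rw [Complex.ofReal_sin, Complex.two_sin]
  have h1 := hne z hz t
  have h2 := hne z hz (-t)
  have h3 := one_sub_two_mul_cos_add_sq z t
  have hpi : (π : ℂ) ≠ 0 := by exact_mod_cast Real.pi_ne_zero
  push_cast at h2 ⊢
  push_cast at h3 hs
  rw [h3]
  generalize Complex.exp (t * Complex.I) = A at *
  generalize Complex.exp (-t * Complex.I) = B at *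
  rw [div_sub_div _ _ h1 h2,
    show -A * (1 - z * B) - (1 - z * A) * -B = B - A by ring]
  linear_combination ((p t : ℂ) / π / ((1 - z * A) * (1 - z * B))) * hs

/-! ### Signs of the derivative and the power series expansion -/

lemma integral_mul_pos_of_ae_pos {p g : ℝ → ℝ} {a b : ℝ} (hab : a < b)
    (hi : IntervalIntegrable (fun t => p t * g t) volume a b)
    (hp : ∀ᵐ t ∂volume.restrict (Set.Ioo a b), 0 < p t) (hg : ∀ t ∈ Set.Ioo a b, 0 < g t) :
    0 < ∫ t in a..b, p t * g t := by
  have hpos : ∀ᵐ t ∂volume.restrict (Set.Ioo a b), 0 < p t * g t := by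
    filter_upwards [hp, ae_restrict_mem measurableSet_Ioo] with t h1 h2
    exact mul_pos h1 (hg t h2)
  rw [intervalIntegral.integral_of_le hab.le, integral_Ioc_eq_integral_Ioo]
  have hi' : IntegrableOn (fun t => p t * g t) (Set.Ioo a b) volume :=
    hi.1.mono_set Set.Ioo_subset_Ioc_self
  rw [integral_pos_iff_support_of_nonneg_ae (hpos.mono fun t ht => ht.le) hi']
  have h1 : (volume.restrict (Set.Ioo a b)) (Function.support fun t => p t * g t) =
      (volume.restrict (Set.Ioo a b)) Set.univ :=
    measure_congr (by
      filter_upwards [hpos] with t ht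
      exact propext ⟨fun _ => trivial, fun _ => ht.ne'⟩)
  rw [h1, Measure.restrict_apply_univ, Real.volume_Ioo]
  simpa using hab

/-- The numerator of the imaginary part is `Im z (1 - |z|²)`. -/
lemma im_div_one_sub_two_mul_cos_add_sq_pos {z : ℂ} (hz : ‖z‖ < 1) (hz0 : 0 < z.im) (t : ℝ) :
    0 < (z / (1 - 2 * z * (Real.cos t : ℂ) + z ^ 2)).im := by
  have hn : z.re ^ 2 + z.im ^ 2 < 1 := by
    have h1 : ‖z‖ ^ 2 = z.re ^ 2 + z.im ^ 2 := by
      rw [Complex.sq_norm, Complex.normSq_apply]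
      ring
    rw [← h1]
    have := norm_nonneg z
    nlinarith
  have hD := Complex.normSq_pos.2 (one_sub_two_mul_cos_add_sq_ne_zero hz t)
  generalize Real.cos t = c at hD ⊢
  rw [Complex.div_im, ← sub_div]
  refine div_pos ?_ hD
  have hre : (1 - 2 * z * (c : ℂ) + z ^ 2).re = 1 - 2 * z.re * c + z.re ^ 2 - z.im ^ 2 := by
    simp [pow_two]
    ring
  have him : (1 - 2 * z * (c : ℂ) + z ^ 2).im = -2 * z.im * c + 2 * z.re * z.im := by
    simp [pow_two]
    ring
  rw [hre, him]
  have : z.im * (1 - 2 * z.re * c + z.re ^ 2 - z.im ^ 2) -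
      z.re * (-2 * z.im * c + 2 * z.re * z.im) = z.im * (1 - (z.re ^ 2 + z.im ^ 2)) := by ring
  rw [this]
  exact mul_pos hz0 (by linarith)

lemma continuous_sin_div {z : ℂ} (hz : ‖z‖ < 1) :
    Continuous fun t : ℝ => (Real.sin t : ℂ) / (1 - 2 * z * (Real.cos t : ℂ) + z ^ 2) :=
  Continuous.div (by fun_prop) (by fun_prop) (one_sub_two_mul_cos_add_sq_ne_zero hz)

/-- The integral is the derivative of the logarithmic potential found in
`hasDerivAt_logPotential`. -/
lemma im_mul_deriv_logPotential_neg {p : ℝ → ℝ} (hp : IntervalIntegrable p volume 0 π)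
    (hpos : ∀ᵐ t ∂volume.restrict (Set.Ioo 0 π), 0 < p t) {z : ℂ} (hz : ‖z‖ < 1)
    (hz0 : 0 < z.im) :
    (z * (-(2 / π) * ∫ t in (0 : ℝ)..π,
      (p t : ℂ) * ((Real.sin t : ℂ) / (1 - 2 * z * (Real.cos t : ℂ) + z ^ 2)))).im < 0 := by
  have h1 : z * (-(2 / π) * ∫ t in (0 : ℝ)..π,
      (p t : ℂ) * ((Real.sin t : ℂ) / (1 - 2 * z * (Real.cos t : ℂ) + z ^ 2))) =
      ((-(2 / π) : ℝ) : ℂ) * ∫ t in (0 : ℝ)..π,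
      (p t : ℂ) * ((Real.sin t : ℂ) * (z / (1 - 2 * z * (Real.cos t : ℂ) + z ^ 2))) := by
    rw [mul_left_comm, ← intervalIntegral.integral_const_mul]
    push_cast
    congr 1
    refine intervalIntegral.integral_congr fun t _ => ?_
    ring
  have hcont : Continuous fun t : ℝ =>
      (Real.sin t : ℂ) * (z / (1 - 2 * z * (Real.cos t : ℂ) + z ^ 2)) := by
    have := (continuous_sin_div hz).const_mul z
    refine this.congr fun t => ?_
    ring
  have him : (∫ t in (0 : ℝ)..π,
      (p t : ℂ) * ((Real.sin t : ℂ) * (z / (1 - 2 * z * (Real.cos t : ℂ) + z ^ 2)))).im =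
      ∫ t in (0 : ℝ)..π, p t * (Real.sin t * (z / (1 - 2 * z * (Real.cos t : ℂ) + z ^ 2)).im) := by
    have := Complex.imCLM.intervalIntegral_comp_comm (hp.ofReal_mul_continuous hcont)
    simp only [Complex.imCLM_apply] at this
    rw [← this]
    refine intervalIntegral.integral_congr fun t _ => ?_
    simp only [Complex.im_ofReal_mul]
  rw [h1, Complex.im_ofReal_mul, him]
  refine mul_neg_of_neg_of_pos (neg_neg_of_pos (div_pos two_pos Real.pi_pos)) ?_
  refine integral_mul_pos_of_ae_pos Real.pi_pos (hp.mul_continuousOn ?_) hpos fun t ht => ?_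
  · have := Complex.continuous_im.comp hcont
    refine (this.congr fun t => ?_).continuousOn
    simp only [Function.comp, Complex.im_ofReal_mul]
  · exact mul_pos (Real.sin_pos_of_pos_of_lt_pi ht.1 ht.2)
      (im_div_one_sub_two_mul_cos_add_sq_pos hz hz0 t)

lemma re_deriv_logPotential_neg {p : ℝ → ℝ} (hp : IntervalIntegrable p volume 0 π)
    (hpos : ∀ᵐ t ∂volume.restrict (Set.Ioo 0 π), 0 < p t) {x : ℝ} (hx : ‖(x : ℂ)‖ < 1) :
    (-(2 / π : ℂ) * ∫ t in (0 : ℝ)..π, (p t : ℂ) *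
      ((Real.sin t : ℂ) / (1 - 2 * x * (Real.cos t : ℂ) + (x : ℂ) ^ 2))).re < 0 := by
  have hden : ∀ t : ℝ, 1 - 2 * x * Real.cos t + x ^ 2 ≠ 0 := fun t => by
    exact_mod_cast one_sub_two_mul_cos_add_sq_ne_zero hx t
  have h1 : -(2 / π : ℂ) * ∫ t in (0 : ℝ)..π, (p t : ℂ) *
      ((Real.sin t : ℂ) / (1 - 2 * x * (Real.cos t : ℂ) + (x : ℂ) ^ 2)) =
      ((-(2 / π) * ∫ t in (0 : ℝ)..π,
        p t * (Real.sin t / (1 - 2 * x * Real.cos t + x ^ 2)) : ℝ) : ℂ) := by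
    rw [Complex.ofReal_mul, ← intervalIntegral.integral_ofReal]
    push_cast
    rfl
  rw [h1, Complex.ofReal_re]
  refine mul_neg_of_neg_of_pos (neg_neg_of_pos (div_pos two_pos Real.pi_pos)) ?_
  refine integral_mul_pos_of_ae_pos Real.pi_pos (hp.mul_continuousOn ?_) hpos fun t ht => ?_
  · exact (Continuous.div (by fun_prop) (by fun_prop) hden).continuousOn
  · refine div_pos (Real.sin_pos_of_pos_of_lt_pi ht.1 ht.2) (lt_of_le_of_ne ?_ (hden t).symm)
    nlinarith [sq_nonneg (x - Real.cos t), Real.sin_sq_add_cos_sq t, sq_nonneg (Real.sin t)]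

/-- The power series with the cosine coefficients of `f` as coefficients is the logarithmic
potential of `f'`: the termwise differentiated Fourier series expresses these coefficients through
`f'`, and `-log (1 - w)` is `∑ wⁿ / n`. -/
lemma hasSum_cosCoeff_mul_pow {f : ℝ → ℝ} (hf : FourierTermwiseDeriv f)
    (hodd : ∀ t, deriv f (-t) = -deriv f t) {z : ℂ} (hz : ‖z‖ < 1) :
    HasSum (fun n : ℕ => (cosCoeff f (n + 1) : ℂ) * z ^ (n + 1)) (logPotential (deriv f) z) := by
  obtain ⟨-, -, hp, hcoeff⟩ := hf
  set p := deriv f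
  have hpi : (π : ℂ) ≠ 0 := by exact_mod_cast Real.pi_ne_zero
  have key := intervalIntegral.hasSum_integral_of_dominated_convergence (a := -π) (b := π)
    (μ := volume)
    (F := fun (n : ℕ) t => (p t : ℂ) *
      -((z * Complex.exp (t * Complex.I)) ^ (n + 1) / ((n + 1 : ℕ) : ℂ)))
    (f := fun t => (p t : ℂ) * Complex.log (1 - z * Complex.exp (t * Complex.I)))
    (fun n t => |p t| * ‖z‖ ^ (n + 1))
    (fun n => (hp.ofReal_mul_continuous (by fun_prop)).aestronglyMeasurable_restrict_uIoc)
    (fun n => Eventually.of_forall fun t _ => by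
      rw [norm_mul, Complex.norm_real, Real.norm_eq_abs, norm_neg, norm_div, norm_pow,
        norm_mul_exp_ofReal_mul_I, Complex.norm_natCast]
      gcongr
      exact div_le_self (by positivity) (by exact_mod_cast Nat.succ_pos n))
    (Eventually.of_forall fun t _ => by
      have := (summable_geometric_of_lt_one (norm_nonneg z) hz).mul_left ‖z‖
      refine Summable.mul_left _ (this.congr fun n => ?_)
      ring)
    (by
      simp_rw [tsum_mul_left]
      exact hp.abs.mul_const _)
    (Eventually.of_forall fun t _ => by
      refine HasSum.mul_left _ ?_
      have h := Complex.hasSum_taylorSeries_neg_log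
        (z := z * Complex.exp (t * Complex.I)) (by rwa [norm_mul_exp_ofReal_mul_I])
      have h2 := (hasSum_nat_add_iff' 1).2 h
      simpa using h2.neg)
  have h := key.mul_left (-(Complex.I / π))
  refine HasSum.congr_fun h fun n => Eq.symm ?_
  have h1 : ∀ t : ℝ, (p t : ℂ) * -((z * Complex.exp (t * Complex.I)) ^ (n + 1) / ((n + 1 : ℕ) : ℂ)) =
      -(z ^ (n + 1) / ((n + 1 : ℕ) : ℂ)) *
      ((p t : ℂ) * Complex.exp (((n + 1 : ℕ) * t : ℝ) * Complex.I)) := fun t => by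
    rw [mul_pow, ← Complex.exp_nat_mul]
    push_cast
    ring_nf
  simp_rw [h1]
  rw [intervalIntegral.integral_const_mul,
    integral_odd_mul hp hodd (g := fun t : ℝ => Complex.exp (((n + 1 : ℕ) * t : ℝ) * Complex.I))
      (by fun_prop)]
  have h2 : ∫ t in (0 : ℝ)..π, (p t : ℂ) * (Complex.exp (((n + 1 : ℕ) * t : ℝ) * Complex.I) -
      Complex.exp (((n + 1 : ℕ) * -t : ℝ) * Complex.I)) =
      ∫ t in (-π)..π, (p t : ℂ) * (Complex.I * (Real.sin ((n + 1 : ℕ) * t) : ℂ)) := by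
    rw [integral_odd_mul hp hodd (g := fun t : ℝ => Complex.I * (Real.sin ((n + 1 : ℕ) * t) : ℂ))
      (by fun_prop)]
    refine intervalIntegral.integral_congr fun t _ => ?_
    simp only [mul_neg, Real.sin_neg, Complex.ofReal_neg]
    rw [Complex.exp_mul_I, Complex.exp_mul_I, Complex.cos_neg, Complex.sin_neg, Complex.ofReal_sin]
    ring
  have h3 : ∫ t in (-π)..π, (p t : ℂ) * (Complex.I * (Real.sin ((n + 1 : ℕ) * t) : ℂ)) =
      Complex.I * (π * (sinCoeff p (n + 1) : ℂ)) := by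
    rw [sinCoeff, Complex.ofReal_mul, ← intervalIntegral.integral_ofReal]
    push_cast
    rw [← mul_assoc (π : ℂ), mul_one_div_cancel hpi, one_mul,
      ← intervalIntegral.integral_const_mul]
    refine intervalIntegral.integral_congr fun t _ => ?_
    ring
  rw [h2, h3, (hcoeff (n + 1)).2]
  have hn : ((n + 1 : ℕ) : ℂ) ≠ 0 := by exact_mod_cast Nat.succ_ne_zero n
  push_cast at hn ⊢
  field_simp
  rw [Complex.I_sq]
  ring

/-! ### The Gross map and its boundary values -/

lemma evenQuantile_neg (μ : Measure ℝ) (θ : ℝ) : evenQuantile μ (-θ) = evenQuantile μ θ := by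
  rw [evenQuantile, evenQuantile, abs_neg]

lemma deriv_evenQuantile_neg (μ : Measure ℝ) (θ : ℝ) :
    deriv (evenQuantile μ) (-θ) = -deriv (evenQuantile μ) θ := by
  have h := deriv_comp_neg (evenQuantile μ) θ
  simp only [evenQuantile_neg] at h
  linarith

lemma grossMap_eq_logPotential {μ : Measure ℝ} (hQ : FourierTermwiseDeriv (evenQuantile μ)) {z : ℂ}
    (hz : ‖z‖ < 1) : grossMap μ z = logPotential (deriv (evenQuantile μ)) z :=
  (hasSum_cosCoeff_mul_pow hQ (deriv_evenQuantile_neg μ) hz).tsum_eq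

lemma isUnivalentOnto_grossMap {μ : Measure ℝ} (hQ : FourierTermwiseDeriv (evenQuantile μ))
    (hpos : ∀ᵐ t ∂volume.restrict (Set.Ioo 0 π), 0 < deriv (evenQuantile μ) t) :
    IsUnivalentOnto (grossMap μ) (grossDomain μ) := by
  have hp := hQ.2.2.1
  have hp0 : IntervalIntegrable (deriv (evenQuantile μ)) volume 0 π := hp.mono_set (by
    rw [Set.uIcc_of_le Real.pi_pos.le, Set.uIcc_of_le (by linarith [Real.pi_pos])]
    exact Set.Icc_subset_Icc_left (by linarith [Real.pi_pos]))
  have hd : ∀ z ∈ Metric.ball (0 : ℂ) 1, HasDerivAt (grossMap μ) _ z := fun z hz =>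
    (hasDerivAt_logPotential hp (deriv_evenQuantile_neg μ)
      (by simpa using hz)).congr_of_eventuallyEq (by
        filter_upwards [Metric.isOpen_ball.mem_nhds hz] with w hw
        exact grossMap_eq_logPotential hQ (by simpa using hw))
  have h0 : grossMap μ 0 = 0 := by simp [grossMap]
  refine ⟨fun z hz => (hd z hz).differentiableAt.differentiableWithinAt, ?_, rfl, h0⟩
  refine injOn_ball_of_im_mul_deriv_neg hd h0 (fun z _ => ?_)
    (fun z hz hz0 => im_mul_deriv_logPotential_neg hp0 hpos (by simpa using hz) hz0)
    (fun x hx => re_deriv_logPotential_neg hp0 hpos (by simpa using hx))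
  rw [grossMap, grossMap, Complex.conj_tsum]
  simp

/-- The argument of `1 - e^{iu}`, the `2π`-periodic sawtooth equal to `(u - π) / 2` on `(0, 2π)`. -/
def sawtooth (u : ℝ) : ℝ :=
  Complex.arg (1 - Complex.exp (u * Complex.I))

lemma measurable_sawtooth : Measurable sawtooth :=
  Complex.measurable_arg.comp (by fun_prop)

lemma abs_sawtooth_le (u : ℝ) : |sawtooth u| ≤ π := Complex.abs_arg_le_pi _

lemma exp_add_two_pi_mul_I (u : ℝ) :
    Complex.exp ((u + 2 * π : ℝ) * Complex.I) = Complex.exp (u * Complex.I) := by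
  push_cast
  rw [add_mul, Complex.exp_periodic]

lemma periodic_sawtooth : Function.Periodic sawtooth (2 * π) := fun u => by
  rw [sawtooth, sawtooth, exp_add_two_pi_mul_I]

lemma sawtooth_eq {u : ℝ} (hu : u ∈ Set.Ioo 0 (2 * π)) : sawtooth u = (u - π) / 2 := by
  have hs : 0 < 2 * Real.sin (u / 2) :=
    mul_pos two_pos (Real.sin_pos_of_pos_of_lt_pi (by linarith [hu.1]) (by linarith [hu.2]))
  have hc : Real.cos ((u - π) / 2) = Real.sin (u / 2) := by
    rw [show (u - π) / 2 = u / 2 - π / 2 by ring, Real.cos_sub_pi_div_two]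
  have hsin : Real.sin ((u - π) / 2) = -Real.cos (u / 2) := by
    rw [show (u - π) / 2 = u / 2 - π / 2 by ring, Real.sin_sub_pi_div_two]
  have h : 1 - Complex.exp (u * Complex.I) = ((2 * Real.sin (u / 2) : ℝ) : ℂ) *
      (Complex.cos (((u - π) / 2 : ℝ) : ℂ) + Complex.sin (((u - π) / 2 : ℝ) : ℂ) * Complex.I) := by
    rw [← Complex.ofReal_cos, ← Complex.ofReal_sin, hc, hsin, Complex.exp_mul_I,
      ← Complex.ofReal_cos, ← Complex.ofReal_sin]
    have h1 : Real.cos u = 1 - 2 * Real.sin (u / 2) ^ 2 := by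
      rw [show u = 2 * (u / 2) by ring, Real.cos_two_mul, Real.cos_sq']
      ring_nf
    have h2 : Real.sin u = 2 * Real.sin (u / 2) * Real.cos (u / 2) := by
      rw [← Real.sin_two_mul]
      ring_nf
    rw [h1, h2]
    push_cast
    ring
  rw [sawtooth, h, Complex.arg_mul_cos_add_sin_mul_I hs
    ⟨by linarith [hu.1, Real.pi_pos], by linarith [hu.2, Real.pi_pos]⟩]

/-- The distributional derivative of a translate of the sawtooth is `1/2` minus `π` times a point
mass at each jump. -/
lemma integral_sawtooth_mul_deriv {φ : ℝ → ℝ} (hφ : ContDiff ℝ ∞ φ)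
    (hper : Function.Periodic φ (2 * π)) (s : ℝ) :
    ∫ θ in (0 : ℝ)..(2 * π), sawtooth (θ + s) * deriv φ θ =
      π * φ (-s) - 1 / 2 * ∫ θ in (0 : ℝ)..(2 * π), φ θ := by
  have hd : ∀ x, HasDerivAt φ (deriv φ x) x := fun x =>
    (hφ.differentiable (by simp)).differentiableAt.hasDerivAt
  have hdc : Continuous (deriv φ) := hφ.continuous_deriv (by simp)
  have hdper : Function.Periodic (deriv φ) (2 * π) := fun x => by
    rw [← deriv_comp_add_const, show (fun y => φ (y + 2 * π)) = φ from funext hper]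
  have hper1 : Function.Periodic (fun θ => sawtooth (θ + s) * deriv φ θ) (2 * π) := fun x => by
    simp only [hdper x, show x + 2 * π + s = x + s + 2 * π by ring, periodic_sawtooth (x + s)]
  have h1 : ∫ θ in (0 : ℝ)..(2 * π), sawtooth (θ + s) * deriv φ θ =
      ∫ u in (0 : ℝ)..(2 * π), sawtooth u * deriv φ (u - s) := by
    have h := hper1.intervalIntegral_add_eq 0 (-s)
    rw [zero_add] at h
    rw [h]
    have h2 := intervalIntegral.integral_comp_sub_right (a := 0) (b := 2 * π)
      (fun θ => sawtooth (θ + s) * deriv φ θ) s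
    rw [zero_sub, show 2 * π - s = -s + 2 * π by ring] at h2
    rw [← h2]
    simp only [sub_add_cancel]
  have h2 : ∫ u in (0 : ℝ)..(2 * π), sawtooth u * deriv φ (u - s) =
      ∫ u in (0 : ℝ)..(2 * π), (u - π) / 2 * deriv φ (u - s) := by
    rw [intervalIntegral.integral_of_le Real.two_pi_pos.le,
      intervalIntegral.integral_of_le Real.two_pi_pos.le, integral_Ioc_eq_integral_Ioo,
      integral_Ioc_eq_integral_Ioo]
    refine setIntegral_congr_fun measurableSet_Ioo fun u hu => ?_
    simp only [sawtooth_eq hu]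
  have h3 := intervalIntegral.integral_mul_deriv_eq_deriv_mul (a := 0) (b := 2 * π)
    (u := fun u => (u - π) / 2) (u' := fun _ => 1 / 2) (v := fun u => φ (u - s))
    (v' := fun u => deriv φ (u - s))
    (fun x _ => ((hasDerivAt_id x).sub_const π).div_const 2)
    (fun x _ => (hd (x - s)).comp_sub_const x s)
    (intervalIntegrable_const) ((hdc.comp (continuous_sub_right s)).intervalIntegrable _ _)
  have h4 : ∫ u in (0 : ℝ)..(2 * π), φ (u - s) = ∫ θ in (0 : ℝ)..(2 * π), φ θ := by
    rw [intervalIntegral.integral_comp_sub_right φ s, zero_sub,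
      show 2 * π - s = -s + 2 * π by ring]
    have h := hper.intervalIntegral_add_eq 0 (-s)
    rw [zero_add] at h
    exact h.symm
  have h5 : φ (2 * π - s) = φ (-s) := by
    rw [show 2 * π - s = -s + 2 * π by ring]
    exact hper _
  rw [h1, h2, h3, intervalIntegral.integral_const_mul, h4, h5, zero_sub]
  ring_nf

lemma one_sub_exp_mem_slitPlane {u : ℝ} (hu : Complex.exp (u * Complex.I) ≠ 1) :
    1 - Complex.exp (u * Complex.I) ∈ Complex.slitPlane := by
  refine Or.inl ?_
  rw [Complex.sub_re, Complex.one_re, sub_pos]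
  have hn := Complex.norm_exp_ofReal_mul_I u
  refine lt_of_le_of_ne ((Complex.re_le_norm _).trans_eq hn) fun h => hu ?_
  have him : (Complex.exp (u * Complex.I)).im = 0 := by
    have h2 : ‖Complex.exp (u * Complex.I)‖ ^ 2 = 1 := by rw [hn, one_pow]
    rw [Complex.sq_norm, Complex.normSq_apply, h] at h2
    nlinarith
  exact Complex.ext (by simpa using h) (by simpa using him)

/-- A bound uniform in `r`, from `‖1 - e^{iu}‖ ≤ 2 ‖1 - r e^{iu}‖ ≤ 4`. -/
lemma norm_log_one_sub_mul_exp_le {r : ℝ} (hr0 : 0 ≤ r) (hr : r < 1) {u : ℝ}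
    (hu : Complex.exp (u * Complex.I) ≠ 1) :
    ‖Complex.log (1 - r * Complex.exp (u * Complex.I))‖ ≤
      |Real.log ‖1 - Complex.exp (u * Complex.I)‖| + (Real.log 2 + π) := by
  set e := Complex.exp (u * Complex.I)
  have he : ‖e‖ = 1 := Complex.norm_exp_ofReal_mul_I u
  have hy : 0 < ‖1 - e‖ := norm_pos_iff.2 (sub_ne_zero.2 (Ne.symm hu))
  have hre : ‖(r : ℂ) * e‖ = r := by
    rw [norm_mul, he, Complex.norm_real, Real.norm_eq_abs, abs_of_nonneg hr0, mul_one]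
  have hx1 : 1 - r ≤ ‖1 - r * e‖ := by
    have := norm_sub_norm_le 1 ((r : ℂ) * e)
    rwa [hre, norm_one] at this
  have hx2 : ‖1 - r * e‖ ≤ 2 := by
    have := norm_sub_le 1 ((r : ℂ) * e)
    rw [hre, norm_one] at this
    linarith
  have hxy : ‖1 - e‖ ≤ 2 * ‖1 - r * e‖ := by
    have h1 : 1 - e = (1 - r * e) + ((r - 1 : ℝ) : ℂ) * e := by
      push_cast
      ring
    have h2 := norm_add_le (1 - r * e) (((r - 1 : ℝ) : ℂ) * e)
    rw [← h1, norm_mul, he, Complex.norm_real, Real.norm_eq_abs, abs_of_neg (by linarith)] at h2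
    linarith
  have hx0 : 0 < ‖1 - r * e‖ := by linarith
  have hlog1 : Real.log ‖1 - r * e‖ ≤ Real.log 2 := Real.log_le_log hx0 hx2
  have hlog2 : Real.log ‖1 - e‖ ≤ Real.log 2 + Real.log ‖1 - r * e‖ := by
    rw [← Real.log_mul two_ne_zero hx0.ne']
    exact Real.log_le_log hy hxy
  have habs : |Real.log ‖1 - r * e‖| ≤ |Real.log ‖1 - e‖| + Real.log 2 := by
    rw [abs_le]
    have := neg_abs_le (Real.log ‖1 - e‖)
    have := abs_nonneg (Real.log ‖1 - e‖)
    constructor <;> linarith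
  have h := Complex.norm_le_abs_re_add_abs_im (Complex.log (1 - r * e))
  rw [Complex.log_re, Complex.log_im] at h
  have := Complex.abs_arg_le_pi (1 - r * e)
  linarith

lemma ae_exp_add_ne_one (β : ℝ) :
    ∀ᵐ t : ℝ, Complex.exp ((β + t : ℝ) * Complex.I) ≠ 1 := by
  refine (Set.Countable.ae_notMem (s := Set.range fun n : ℤ => 2 * π * n - β)
    (Set.countable_range _) volume).mono fun t ht h => ht ?_
  obtain ⟨n, hn⟩ := Complex.exp_eq_one_iff.1 h
  refine ⟨n, ?_⟩
  have h1 : ((β + t : ℝ) : ℂ) = ((n * (2 * π) : ℝ) : ℂ) := by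
    refine mul_right_cancel₀ Complex.I_ne_zero ?_
    rw [hn]
    push_cast
    ring
  have h2 := Complex.ofReal_injective h1
  simp only
  linarith

lemma measurable_log_norm_one_sub_exp :
    Measurable fun u : ℝ => |Real.log ‖1 - Complex.exp (u * Complex.I)‖| := by
  have h1 : Measurable fun u : ℝ => Real.log ‖1 - Complex.exp (u * Complex.I)‖ :=
    Real.measurable_log.comp (by fun_prop)
  exact h1.norm

/-- Where the integral defining the logarithmic potential converges absolutely on the
boundary, it is the radial limit of the values inside, by dominated convergence. -/
lemma tendsto_logPotential {p : ℝ → ℝ} (hp : IntervalIntegrable p volume (-π) π) {β : ℝ}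
    (hβ : IntervalIntegrable
      (fun t => p t * |Real.log ‖1 - Complex.exp ((β + t : ℝ) * Complex.I)‖|) volume (-π) π) :
    Tendsto (fun r : ℝ => logPotential p ((r : ℂ) * Complex.exp (β * Complex.I))) (𝓝[<] 1)
        (𝓝 (logPotential p (Complex.exp (β * Complex.I)))) ∧
      (logPotential p (Complex.exp (β * Complex.I))).re =
        1 / π * ∫ t in (-π)..π, p t * sawtooth (β + t) := by
  have hexp : ∀ (r : ℂ) (t : ℝ), r * Complex.exp (β * Complex.I) * Complex.exp (t * Complex.I) =
      r * Complex.exp ((β + t : ℝ) * Complex.I) := fun r t => by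
    rw [mul_assoc, ← Complex.exp_add]
    push_cast
    ring_nf
  have hexp1 : ∀ t : ℝ, Complex.exp (β * Complex.I) * Complex.exp (t * Complex.I) =
      Complex.exp ((β + t : ℝ) * Complex.I) := fun t => by
    simpa using hexp 1 t
  have hpc : AEStronglyMeasurable (fun t => (p t : ℂ)) (volume.restrict (Set.uIoc (-π) π)) :=
    Complex.continuous_ofReal.comp_aestronglyMeasurable hp.aestronglyMeasurable_restrict_uIoc
  have hlim : ∀ t : ℝ, Complex.exp ((β + t : ℝ) * Complex.I) ≠ 1 →
      Tendsto (fun r : ℝ => Complex.log (1 - r * Complex.exp ((β + t : ℝ) * Complex.I)))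
        (𝓝[<] 1) (𝓝 (Complex.log (1 - Complex.exp ((β + t : ℝ) * Complex.I)))) := fun t ht => by
    refine (Tendsto.clog ?_ (one_sub_exp_mem_slitPlane ht))
    have hc : Continuous fun r : ℝ => 1 - (r : ℂ) * Complex.exp ((β + t : ℝ) * Complex.I) := by
      fun_prop
    have := (hc.tendsto 1).mono_left (nhdsWithin_le_nhds (s := Set.Iio 1))
    simpa using this
  have hbound : IntervalIntegrable (fun t => |p t| *
      (|Real.log ‖1 - Complex.exp ((β + t : ℝ) * Complex.I)‖| + (Real.log 2 + π)))
      volume (-π) π := by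
    refine ((hβ.abs.add (hp.abs.mul_const (Real.log 2 + π)))).congr fun t _ => ?_
    simp only [abs_mul, abs_abs]
    ring
  have hIoo : ∀ᶠ r : ℝ in 𝓝[<] 1, r ∈ Set.Ioo (0 : ℝ) 1 := Ioo_mem_nhdsLT zero_lt_one
  have hint : IntervalIntegrable (fun t => (p t : ℂ) *
      Complex.log (1 - Complex.exp ((β + t : ℝ) * Complex.I))) volume (-π) π := by
    refine hbound.mono_fun (hpc.mul (Measurable.aestronglyMeasurable
      (Complex.measurable_log.comp (by fun_prop)))) ?_
    filter_upwards [ae_restrict_of_ae (ae_exp_add_ne_one β)] with t ht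
    rw [norm_mul, Complex.norm_real, norm_mul, norm_abs_eq_norm]
    gcongr
    refine (le_of_tendsto (hlim t ht).norm ?_).trans (le_abs_self _)
    filter_upwards [hIoo] with r hr
    exact norm_log_one_sub_mul_exp_le hr.1.le hr.2 ht
  constructor
  · refine Tendsto.const_mul _ ?_
    refine intervalIntegral.tendsto_integral_filter_of_dominated_convergence _ ?_ ?_ hbound ?_
    · exact Eventually.of_forall fun r => hpc.mul (Measurable.aestronglyMeasurable
        (Complex.measurable_log.comp (by fun_prop)))
    · filter_upwards [hIoo] with r hr
      filter_upwards [ae_exp_add_ne_one β] with t ht _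
      rw [norm_mul, Complex.norm_real, Real.norm_eq_abs, hexp]
      gcongr
      exact norm_log_one_sub_mul_exp_le hr.1.le hr.2 ht
    · filter_upwards [ae_exp_add_ne_one β] with t ht _
      simp only [hexp, hexp1]
      exact (hlim t ht).const_mul _
  · have h1 : ∀ w : ℂ, (-(Complex.I / π) * w).re = 1 / π * w.im := fun w => by
      have : -(Complex.I / π) * w = ((1 / π : ℝ) : ℂ) * (-(Complex.I * w)) := by
        push_cast
        ring
      rw [this, Complex.re_ofReal_mul]
      simp
    rw [logPotential, h1]
    congr 1
    simp only [hexp1]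
    have := Complex.imCLM.intervalIntegral_comp_comm hint
    simp only [Complex.imCLM_apply] at this
    rw [← this]
    refine intervalIntegral.integral_congr fun t _ => ?_
    simp only [Complex.im_ofReal_mul, Complex.log_im, sawtooth]

/-! ### The distributional derivative of the boundary values -/

lemma intervalIntegrable_log_norm_one_sub_exp (a b : ℝ) :
    IntervalIntegrable (fun u : ℝ => |Real.log ‖1 - Complex.exp (u * Complex.I)‖|) volume a b := by
  have h := (circleIntegrable_log_norm_sub_const (a := (1 : ℂ)) (c := 0) 1)
  have h2 : IntervalIntegrable (fun u : ℝ => |Real.log ‖1 - Complex.exp (u * Complex.I)‖|)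
      volume 0 (0 + 2 * π) := by
    rw [zero_add]
    refine (IntervalIntegrable.abs h).congr fun u _ => ?_
    simp [circleMap, norm_sub_rev]
  refine Function.Periodic.intervalIntegrable (T := 2 * π) (fun u => ?_)
    Real.two_pi_pos.ne' h2 a b
  simp only [exp_add_two_pi_mul_I]

/-- Tonelli: the logarithmic singularity is integrable over a period. -/
lemma ae_intervalIntegrable_mul_log {p : ℝ → ℝ} (hp : IntervalIntegrable p volume (-π) π) (α : ℝ) :
    ∀ᵐ θ ∂volume.restrict (Set.Ioc (0 : ℝ) (2 * π)), IntervalIntegrable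
      (fun t => p t * |Real.log ‖1 - Complex.exp ((θ + α + t : ℝ) * Complex.I)‖|)
      volume (-π) π := by
  have hle : -π ≤ π := by linarith [Real.pi_pos]
  set M : ℝ → ℝ := fun u => |Real.log ‖1 - Complex.exp (u * Complex.I)‖| with hM
  have hMm : Measurable M := measurable_log_norm_one_sub_exp
  have hM2 : ∀ t : ℝ, IntervalIntegrable (fun θ => M (θ + α + t)) volume 0 (2 * π) := fun t => by
    have h := (intervalIntegrable_log_norm_one_sub_exp (0 + (α + t)) (2 * π + (α + t))).comp_add_right
      (α + t)
    simp only [add_sub_cancel_right] at h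
    refine h.congr fun θ _ => ?_
    simp only [hM, add_assoc]
  have hMper : Function.Periodic M (2 * π) := fun u => by
    simp only [hM, exp_add_two_pi_mul_I]
  have hconst : ∀ t : ℝ, ∫ θ in Set.Ioc (0 : ℝ) (2 * π), M (θ + α + t) =
      ∫ θ in (0 : ℝ)..(2 * π), M θ := fun t => by
    rw [← intervalIntegral.integral_of_le Real.two_pi_pos.le]
    simp only [add_assoc]
    rw [intervalIntegral.integral_comp_add_right M (α + t), zero_add, add_comm (2 * π)]
    have := hMper.intervalIntegral_add_eq (α + t) 0
    rwa [zero_add] at this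
  have hi : Integrable (fun x : ℝ × ℝ => p x.1 * M (x.2 + α + x.1))
      ((volume.restrict (Set.Ioc (-π) π)).prod (volume.restrict (Set.Ioc (0 : ℝ) (2 * π)))) := by
    rw [integrable_prod_iff]
    · refine ⟨Eventually.of_forall fun t => (hM2 t).1.const_mul (p t), ?_⟩
      refine (hp.1.norm.mul_const (∫ θ in (0 : ℝ)..(2 * π), M θ)).congr
        (Eventually.of_forall fun t => ?_)
      simp only [norm_mul]
      rw [integral_const_mul, ← hconst t]
      congr 1
      refine integral_congr_ae (Eventually.of_forall fun θ => ?_)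
      simp only [hM, Real.norm_eq_abs, abs_abs]
    · exact hp.1.aestronglyMeasurable.comp_fst.mul
        (hMm.comp (by fun_prop : Measurable fun x : ℝ × ℝ => x.2 + α + x.1)).aestronglyMeasurable
  filter_upwards [hi.prod_left_ae] with θ hθ
  rwa [intervalIntegrable_iff_integrableOn_Ioc_of_le hle]

/-- The `2π`-periodic extension of the restriction of `p` to `(-π, π]`. -/
def periodicExtension (p : ℝ → ℝ) (t : ℝ) : ℝ :=
  p (toIocMod Real.two_pi_pos (-π) t)

lemma periodic_periodicExtension (p : ℝ → ℝ) :
    Function.Periodic (periodicExtension p) (2 * π) := fun t => by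
  rw [periodicExtension, periodicExtension, toIocMod_add_right]

lemma periodicExtension_eq (p : ℝ → ℝ) {t : ℝ} (ht : t ∈ Set.Ioc (-π) π) :
    periodicExtension p t = p t := by
  rw [periodicExtension, (toIocMod_eq_self Real.two_pi_pos).2]
  rwa [show -π + 2 * π = π by ring]

lemma intervalIntegrable_periodicExtension {p : ℝ → ℝ} (hp : IntervalIntegrable p volume (-π) π)
    (a b : ℝ) : IntervalIntegrable (periodicExtension p) volume a b := by
  refine (periodic_periodicExtension p).intervalIntegrable Real.two_pi_pos.ne' (t := -π) ?_ a b
  rw [show -π + 2 * π = π by ring]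
  refine hp.congr fun t ht => ?_
  rw [Set.uIoc_of_le (by linarith [Real.pi_pos])] at ht
  exact (periodicExtension_eq p ht).symm

/-- By Fubini the test function meets the sawtooth first; the constant in the derivative of the
sawtooth disappears because the odd function `p` has mean zero. -/
lemma isDistribDeriv_boundary {p : ℝ → ℝ} (hp : IntervalIntegrable p volume (-π) π)
    (hodd : ∀ t, p (-t) = -p t) (α : ℝ) {h : ℝ → ℝ}
    (hh : ∀ᵐ θ ∂volume.restrict (Set.Ioc (0 : ℝ) (2 * π)),
      h θ = 1 / π * ∫ t in (-π)..π, p t * sawtooth (θ + α + t)) :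
    IsDistribDeriv h fun θ => periodicExtension p (θ + α) := by
  have hle : -π ≤ π := by linarith [Real.pi_pos]
  have hpi := Real.pi_pos
  have hprod : ∀ ψ : ℝ → ℝ, Continuous ψ →
      Integrable (fun x : ℝ × ℝ => sawtooth (x.2 + α + x.1) * (p x.1 * ψ x.2))
      ((volume.restrict (Set.Ioc (-π) π)).prod (volume.restrict (Set.Ioc (0 : ℝ) (2 * π)))) := by
    intro ψ hψ
    have hψi : Integrable ψ (volume.restrict (Set.Ioc (0 : ℝ) (2 * π))) :=
      (hψ.intervalIntegrable 0 (2 * π)).1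
    refine (hp.1.mul_prod hψi).bdd_mul (c := π) ?_ ?_
    · exact (measurable_sawtooth.comp
        (by fun_prop : Measurable fun x : ℝ × ℝ => x.2 + α + x.1)).aestronglyMeasurable
    · exact Eventually.of_forall fun x => abs_sawtooth_le _
  have hhi : IntervalIntegrable h volume 0 (2 * π) := by
    rw [intervalIntegrable_iff_integrableOn_Ioc_of_le Real.two_pi_pos.le]
    refine Integrable.congr ((hprod (fun _ => 1) continuous_const).integral_prod_right.const_mul
      (1 / π)) ?_
    filter_upwards [hh] with θ hθ
    rw [hθ, intervalIntegral.integral_of_le hle]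
    simp only [mul_one, mul_comm (sawtooth _)]
  refine ⟨hhi, ?_, fun φ hφ hper => ?_⟩
  · have := (intervalIntegrable_periodicExtension hp (0 + α) (2 * π + α)).comp_add_right α
    simpa only [add_sub_cancel_right] using this
  have hdc : Continuous (deriv φ) := hφ.continuous_deriv (by simp)
  have hp0 : ∫ t in (-π)..π, p t = 0 := by
    have h1 := intervalIntegral.integral_comp_neg (a := -π) (b := π) p
    simp only [hodd, intervalIntegral.integral_neg, neg_neg] at h1
    linarith
  have h1 : ∫ θ in (0 : ℝ)..(2 * π), h θ * deriv φ θ =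
      1 / π * ∫ t in (-π)..π, p t * ∫ θ in (0 : ℝ)..(2 * π), sawtooth (θ + (α + t)) * deriv φ θ := by
    have hsw := integral_integral_swap
      (f := fun t θ => sawtooth (θ + α + t) * (p t * deriv φ θ)) (hprod (deriv φ) hdc)
    rw [intervalIntegral.integral_of_le Real.two_pi_pos.le, intervalIntegral.integral_of_le hle]
    have h2 : ∫ θ in Set.Ioc (0 : ℝ) (2 * π), h θ * deriv φ θ =
        ∫ θ in Set.Ioc (0 : ℝ) (2 * π), 1 / π * ∫ t in Set.Ioc (-π) π,
          sawtooth (θ + α + t) * (p t * deriv φ θ) := by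
      refine integral_congr_ae ?_
      filter_upwards [hh] with θ hθ
      rw [hθ, intervalIntegral.integral_of_le hle, mul_assoc, ← integral_mul_const]
      congr 1
      refine integral_congr_ae (Eventually.of_forall fun t => ?_)
      ring
    rw [h2, integral_const_mul]
    congr 1
    refine hsw.symm.trans (integral_congr_ae (Eventually.of_forall fun t => ?_))
    simp only
    rw [intervalIntegral.integral_of_le Real.two_pi_pos.le, ← integral_const_mul]
    refine integral_congr_ae (Eventually.of_forall fun θ => ?_)
    simp only [add_assoc]
    ring
  have hφi : IntervalIntegrable (fun t => p t * φ (-(α + t))) volume (-π) π :=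
    hp.mul_continuousOn (hφ.continuous.comp (by fun_prop)).continuousOn
  have h3 : 1 / π * ∫ t in (-π)..π, p t * (π * φ (-(α + t)) -
      1 / 2 * ∫ θ in (0 : ℝ)..(2 * π), φ θ) = ∫ t in (-π)..π, p t * φ (-(α + t)) := by
    have h4 : ∀ t, p t * (π * φ (-(α + t)) - 1 / 2 * ∫ θ in (0 : ℝ)..(2 * π), φ θ) =
        π * (p t * φ (-(α + t))) - p t * (1 / 2 * ∫ θ in (0 : ℝ)..(2 * π), φ θ) := fun t => by ring
    simp only [h4]
    rw [intervalIntegral.integral_sub (hφi.const_mul π) (hp.mul_const _),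
      intervalIntegral.integral_const_mul, intervalIntegral.integral_mul_const, hp0, zero_mul,
      sub_zero, ← mul_assoc, one_div_mul_cancel hpi.ne', one_mul]
  have h5 : ∫ t in (-π)..π, p t * φ (-(α + t)) = -∫ t in (-π)..π, p t * φ (t - α) := by
    have := intervalIntegral.integral_comp_neg (a := -π) (b := π) fun t => p t * φ (-(α + t))
    rw [neg_neg] at this
    rw [← this, ← intervalIntegral.integral_neg]
    refine intervalIntegral.integral_congr fun t _ => ?_
    simp only [hodd]
    rw [show -(α + -t) = t - α by ring, neg_mul]
  have hperF : Function.Periodic (fun t => periodicExtension p t * φ (t - α)) (2 * π) := fun t => by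
    simp only [periodic_periodicExtension p t, show t + 2 * π - α = t - α + 2 * π by ring,
      hper (t - α)]
  have h6 : ∫ t in (-π)..π, p t * φ (t - α) =
      ∫ θ in (0 : ℝ)..(2 * π), periodicExtension p (θ + α) * φ θ := by
    have h7 := intervalIntegral.integral_comp_add_right (a := 0) (b := 2 * π)
      (fun t => periodicExtension p t * φ (t - α)) α
    simp only [add_sub_cancel_right] at h7
    have h8 := hperF.intervalIntegral_add_eq (-π) α
    rw [show -π + 2 * π = π by ring] at h8
    rw [h7, zero_add, add_comm (2 * π), ← h8]
    rw [intervalIntegral.integral_of_le hle, intervalIntegral.integral_of_le hle]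
    refine setIntegral_congr_fun measurableSet_Ioc fun t ht => ?_
    simp only [periodicExtension_eq p ht]
  rw [h1, ← h6, ← h5, ← h3]
  simp only [integral_sawtooth_mul_deriv hφ hper]

/-- The `2π`-periodic extension of a smooth function supported in `(0, 2π)` is smooth: near a point
it is the sum of two neighbouring translates. -/
lemma contDiff_comp_toIcoMod {g : ℝ → ℝ} (hg : ContDiff ℝ ∞ g)
    (hsupp : ∀ x, x ∉ Set.Ioo 0 (2 * π) → g x = 0) :
    ContDiff ℝ ∞ fun t => g (toIcoMod Real.two_pi_pos 0 t) := by
  rw [contDiff_iff_contDiffAt]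
  intro x
  set k : ℤ := round (x / (2 * π)) with hk
  have h2 := Real.two_pi_pos
  have hx1 : 2 * π * (k - 1) < x ∧ x < 2 * π * (k + 1) := by
    have h := abs_le.1 (abs_sub_round (x / (2 * π)))
    rw [← hk] at h
    have e : 2 * π * (x / (2 * π)) = x := mul_div_cancel₀ _ h2.ne'
    constructor
    · nlinarith [h.1]
    · nlinarith [h.2]
  have hsm : ContDiffAt ℝ ∞ (fun t => g (t - 2 * π * k) + g (t - 2 * π * (k - 1))) x := by
    refine ContDiff.contDiffAt ?_
    exact (hg.comp (contDiff_id.sub contDiff_const)).add (hg.comp (contDiff_id.sub contDiff_const))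
  refine hsm.congr_of_eventuallyEq ?_
  filter_upwards [Ioo_mem_nhds hx1.1 hx1.2] with t ht
  rcases lt_or_ge t (2 * π * k) with h | h
  · have h1 : toIcoMod h2 0 t = t - 2 * π * (k - 1) := by
      rw [toIcoMod_eq_iff]
      refine ⟨⟨by linarith [ht.1], by linarith⟩, k - 1, ?_⟩
      rw [zsmul_eq_mul]
      push_cast
      ring
    rw [h1, hsupp (t - 2 * π * k) (fun hc => by linarith [hc.1]), zero_add]
  · have h1 : toIcoMod h2 0 t = t - 2 * π * k := by
      rw [toIcoMod_eq_iff]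
      refine ⟨⟨by linarith, by linarith [ht.2]⟩, k, ?_⟩
      rw [zsmul_eq_mul]
      ring
    rw [h1, hsupp (t - 2 * π * (k - 1)) (fun hc => by linarith [hc.2]), add_zero]

/-- Every smooth function supported in `(0, 2π)` extends to a periodic test function. -/
lemma IsDistribDeriv.ae_eq {f g₁ g₂ : ℝ → ℝ} (h₁ : IsDistribDeriv f g₁)
    (h₂ : IsDistribDeriv f g₂) : g₁ =ᵐ[volume.restrict (Set.Ioo 0 (2 * π))] g₂ := by
  have hi : IntegrableOn (fun t => g₁ t - g₂ t) (Set.Ioo 0 (2 * π)) volume :=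
    (h₁.2.1.1.sub h₂.2.1.1).mono_set Set.Ioo_subset_Ioc_self
  have hz := isOpen_Ioo.ae_eq_zero_of_integral_contDiff_smul_eq_zero (μ := volume)
    hi.locallyIntegrableOn (fun g hg hgc hgs => by
      have hsupp : ∀ x, x ∉ Set.Ioo 0 (2 * π) → g x = 0 := fun x hx =>
        image_eq_zero_of_notMem_tsupport fun h => hx (hgs h)
      set φ : ℝ → ℝ := fun t => g (toIcoMod Real.two_pi_pos 0 t) with hφdef
      have hφ : ContDiff ℝ ∞ φ := contDiff_comp_toIcoMod hg hsupp
      have hper : Function.Periodic φ (2 * π) := fun t => by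
        simp only [hφdef, toIcoMod_add_right]
      have he : ∀ t ∈ Set.Ioo 0 (2 * π), φ t = g t := fun t ht => by
        simp only [hφdef]
        rw [(toIcoMod_eq_self Real.two_pi_pos).2 (by rw [zero_add]; exact Set.Ioo_subset_Ico_self ht)]
      have h3 := (h₁.2.2 φ hφ hper).symm.trans (h₂.2.2 φ hφ hper)
      rw [neg_inj] at h3
      have h4 : ∫ t in (0 : ℝ)..(2 * π), (g₁ t - g₂ t) * φ t = 0 := by
        simp only [sub_mul]
        rw [intervalIntegral.integral_sub (h₁.2.1.mul_continuousOn hφ.continuous.continuousOn)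
          (h₂.2.1.mul_continuousOn hφ.continuous.continuousOn), h3, sub_self]
      rw [intervalIntegral.integral_of_le Real.two_pi_pos.le, integral_Ioc_eq_integral_Ioo] at h4
      rw [← h4, ← setIntegral_eq_integral_of_forall_compl_eq_zero (s := Set.Ioo 0 (2 * π))
        (fun x hx => by rw [hsupp x hx, zero_smul])]
      refine setIntegral_congr_fun measurableSet_Ioo fun t ht => ?_
      simp only [he t ht, smul_eq_mul, mul_comm])
  refine (ae_restrict_iff' measurableSet_Ioo).2 ?_
  filter_upwards [hz] with t ht hmem
  exact sub_eq_zero.1 (ht hmem)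

lemma IsDistribDeriv.kineticEnergy_eq {f g : ℝ → ℝ} (h : IsDistribDeriv f g) :
    kineticEnergy f = ENNReal.ofReal (1 / 2 * (1 / (2 * π))) *
      ∫⁻ t in Set.Ioo (0 : ℝ) (2 * π), ENNReal.ofReal (|g t| ^ 2) := by
  refine le_antisymm (iInf₂_le g h) (le_iInf₂ fun g' h' => le_of_eq ?_)
  congr 1
  refine lintegral_congr_ae ?_
  filter_upwards [h.ae_eq h'] with t ht
  rw [ht]

lemma lintegral_periodicExtension_add (p : ℝ → ℝ) (α : ℝ) :
    ∫⁻ t in Set.Ioo (0 : ℝ) (2 * π), ENNReal.ofReal (|periodicExtension p (t + α)| ^ 2) =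
      ∫⁻ t in Set.Ioo (-π) π, ENNReal.ofReal (|p t| ^ 2) := by
  set F : ℝ → ℝ≥0∞ := fun t => ENNReal.ofReal (|periodicExtension p t| ^ 2)
  have h1 : ∫⁻ t in Set.Ioc (0 : ℝ) (2 * π), F (t + α) = ∫⁻ t in Set.Ioc α (α + 2 * π), F t := by
    have h := (measurePreserving_add_right volume α).setLIntegral_comp_preimage_emb
      (measurableEmbedding_addRight α) F (Set.Ioc α (α + 2 * π))
    rw [← h, Set.preimage_add_const_Ioc, sub_self, add_sub_cancel_left]
  have h2 : ∫⁻ t in Set.Ioc α (α + 2 * π), F t = ∫⁻ t in Set.Ioc (-π) (-π + 2 * π), F t := by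
    refine (isAddFundamentalDomain_Ioc Real.two_pi_pos α).setLIntegral_eq
      (isAddFundamentalDomain_Ioc Real.two_pi_pos (-π)) F ?_
    rintro ⟨c, n, rfl⟩ x
    simp only [F]
    congr 3
    have := (periodic_periodicExtension p).zsmul n x
    rw [← this, AddSubgroup.vadd_def, vadd_eq_add, add_comm]
  rw [setLIntegral_congr Ioo_ae_eq_Ioc, h1, h2, show -π + 2 * π = π by ring,
    setLIntegral_congr Ioo_ae_eq_Ioc]
  refine setLIntegral_congr_fun measurableSet_Ioc fun t ht => ?_
  simp only [F, periodicExtension_eq p ht]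

/-- Up to the constant, the energy of every rotation of the logarithmic potential of an odd `p` is
the squared norm of `p`. -/
lemma kineticEnergy_radialLimit {p : ℝ → ℝ} (hp : IntervalIntegrable p volume (-π) π)
    (hodd : ∀ t, p (-t) = -p t) (α : ℝ) {f : ℂ → ℂ}
    (hf : ∀ z ∈ Metric.ball (0 : ℂ) 1, f z = logPotential p (z * Complex.exp (α * Complex.I))) :
    kineticEnergy (fun θ => (radialLimit f θ).re) = ENNReal.ofReal (1 / 2 * (1 / (2 * π))) *
      ∫⁻ t in Set.Ioo (-π) π, ENNReal.ofReal (|p t| ^ 2) := by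
  rw [← lintegral_periodicExtension_add p α]
  refine (isDistribDeriv_boundary hp hodd α ?_).kineticEnergy_eq
  filter_upwards [ae_intervalIntegrable_mul_log hp α] with θ hθ
  obtain ⟨hlim, hre⟩ := tendsto_logPotential hp hθ
  rw [← hre, radialLimit]
  congr 1
  refine Tendsto.limUnder_eq (hlim.congr' ?_)
  filter_upwards [Ioo_mem_nhdsLT (zero_lt_one : (0 : ℝ) < 1)] with r hr
  rw [hf]
  · congr 1
    rw [mul_assoc, ← Complex.exp_add]
    push_cast
    ring_nf
  · rw [mem_ball_zero_iff, norm_mul_exp_ofReal_mul_I, Complex.norm_real, Real.norm_eq_abs,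
      abs_of_pos hr.1]
    exact hr.2

/-! ### The quantile function and the density -/

lemma quantile_le_iff (μ : Measure ℝ) [IsProbabilityMeasure μ] {u : ℝ} (hu : u ∈ Set.Ioo (0 : ℝ) 1)
    (x : ℝ) : quantile μ u ≤ x ↔ u ≤ cdf μ x := by
  have hbdd : BddBelow {x : ℝ | u ≤ cdf μ x} := by
    obtain ⟨y, hy⟩ := ((tendsto_cdf_atBot μ).eventually_lt_const hu.1).exists
    refine ⟨y, fun x hx => ?_⟩
    by_contra hcon
    exact absurd (lt_of_le_of_lt hx ((monotone_cdf μ (not_le.1 hcon).le).trans_lt hy)) (lt_irrefl u)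
  have hne : {x : ℝ | u ≤ cdf μ x}.Nonempty :=
    (((tendsto_cdf_atTop μ).eventually_const_lt hu.2).mono fun x hx => hx.le).exists
  refine ⟨fun h => ?_, fun h => csInf_le hbdd h⟩
  have hgt : ∀ y, x < y → u ≤ cdf μ y := fun y hy => by
    obtain ⟨w, hw, hwy⟩ := exists_lt_of_csInf_lt hne (lt_of_le_of_lt h hy)
    exact le_trans hw (monotone_cdf μ hwy.le)
  refine ge_of_tendsto (((cdf μ).right_continuous x).mono_left
    (nhdsWithin_mono x Set.Ioi_subset_Ici_self)) ?_
  filter_upwards [self_mem_nhdsWithin] with y hy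
  exact hgt y hy

lemma cdf_quantile (μ : Measure ℝ) [IsProbabilityMeasure μ] [NullSingletonClass μ] {u : ℝ}
    (hu : u ∈ Set.Ioo (0 : ℝ) 1) : cdf μ (quantile μ u) = u := by
  refine le_antisymm ?_ ((quantile_le_iff μ hu _).1 le_rfl)
  -- Without atoms the distribution function is continuous from the left.
  have hleft : cdf μ (quantile μ u) ≤ Function.leftLim (cdf μ) (quantile μ u) := by
    have h := (cdf μ).measure_singleton (quantile μ u)
    rw [measure_cdf, measure_singleton] at h
    linarith [ENNReal.ofReal_eq_zero.1 h.symm]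
  refine hleft.trans (le_of_tendsto ((monotone_cdf μ).tendsto_leftLim _) ?_)
  filter_upwards [self_mem_nhdsWithin] with y hy
  by_contra hcon
  exact absurd ((quantile_le_iff μ hu y).2 (not_le.1 hcon).le) (not_le.2 hy)

lemma monotoneOn_quantile (μ : Measure ℝ) [IsProbabilityMeasure μ] :
    MonotoneOn (quantile μ) (Set.Ioo 0 1) := fun _ hu _ hv huv =>
  (quantile_le_iff μ hu _).2 (huv.trans ((quantile_le_iff μ hv _).1 le_rfl))

lemma map_quantile (μ : Measure ℝ) [IsProbabilityMeasure μ] :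
    (volume.restrict (Set.Ioo (0 : ℝ) 1)).map (quantile μ) = μ := by
  have hm : AEMeasurable (quantile μ) (volume.restrict (Set.Ioo (0 : ℝ) 1)) :=
    aemeasurable_restrict_of_monotoneOn measurableSet_Ioo (monotoneOn_quantile μ)
  have : IsFiniteMeasure ((volume.restrict (Set.Ioo (0 : ℝ) 1)).map (quantile μ)) :=
    Measure.isFiniteMeasure_map _ _
  refine Measure.ext_of_Iic _ _ fun x => ?_
  rw [Measure.map_apply_of_aemeasurable hm measurableSet_Iic,
    Measure.restrict_apply' measurableSet_Ioo, ← ofReal_cdf]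
  have h1 : quantile μ ⁻¹' Set.Iic x ∩ Set.Ioo 0 1 = Set.Iic (cdf μ x) ∩ Set.Ioo 0 1 := by
    ext u
    constructor
    · exact fun h => ⟨(quantile_le_iff μ h.2 x).1 h.1, h.2⟩
    · exact fun h => ⟨(quantile_le_iff μ h.2 x).2 h.1, h.2⟩
  have h2 : volume (Set.Iic (cdf μ x) ∩ Set.Ioo 0 1) = volume (Set.Ioc 0 (cdf μ x)) := by
    rw [measure_congr ((ae_eq_refl (Set.Iic (cdf μ x))).inter (Ioo_ae_eq_Ioc (μ := volume)))]
    congr 1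
    ext u
    have := cdf_le_one μ x
    simp only [Set.mem_inter_iff, Set.mem_Iic, Set.mem_Ioc]
    constructor
    · exact fun h => ⟨h.2.1, h.1⟩
    · exact fun h => ⟨h.2, h.1, h.2.trans this⟩
  rw [h1, h2, Real.volume_Ioc, sub_zero]

lemma ae_hasDerivAt_cdf {μ : Measure ℝ} [IsProbabilityMeasure μ] {ρ : ℝ → ℝ}
    (hρ_meas : Measurable ρ) (hρ_nonneg : ∀ x, 0 ≤ ρ x)
    (hρ : μ = volume.withDensity fun x => ENNReal.ofReal (ρ x)) :
    ∀ᵐ x : ℝ, HasDerivAt (cdf μ) (ρ x) x := by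
  have h1 := (cdf μ).ae_hasDerivAt
  rw [measure_cdf] at h1
  have h2 : μ.rnDeriv volume =ᵐ[volume] fun x => ENNReal.ofReal (ρ x) := by
    rw [hρ]
    exact Measure.rnDeriv_withDensity _ hρ_meas.ennreal_ofReal
  filter_upwards [h1, h2] with x h3 h4
  rwa [h4, ENNReal.toReal_ofReal (hρ_nonneg x)] at h3

lemma map_mul_inv_pi_restrict :
    (volume.restrict (Set.Ioo 0 π)).map (fun θ => θ * π⁻¹) =
      ENNReal.ofReal π • volume.restrict (Set.Ioo (0 : ℝ) 1) := by
  have hpi := Real.pi_pos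
  have hpre : Set.Ioo 0 π = (fun θ => θ * π⁻¹) ⁻¹' Set.Ioo (0 : ℝ) 1 := by
    ext θ
    simp only [Set.mem_Ioo, Set.mem_preimage, ← div_eq_mul_inv, lt_div_iff₀ hpi, div_lt_iff₀ hpi,
      zero_mul, one_mul]
  rw [hpre, ← Measure.restrict_map (by fun_prop) measurableSet_Ioo,
    Real.map_volume_mul_right (inv_ne_zero hpi.ne'), inv_inv, abs_of_pos hpi,
    Measure.restrict_smul]

/-- Differentiating `F(Q(θ/π)) = θ/π`, where the derivative `ρ` of `F` exists at `Q(u)` for almost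
every `u` because `Q` carries the Lebesgue measure of `(0, 1)` to `μ`. -/
lemma ae_density_mul_deriv_evenQuantile {μ : Measure ℝ} [IsProbabilityMeasure μ] {ρ : ℝ → ℝ}
    (hρ_meas : Measurable ρ) (hρ_nonneg : ∀ x, 0 ≤ ρ x)
    (hρ : μ = volume.withDensity fun x => ENNReal.ofReal (ρ x))
    (hQ : FourierTermwiseDeriv (evenQuantile μ)) :
    ∀ᵐ θ ∂volume.restrict (Set.Ioo 0 π),
      ρ (quantile μ (θ * π⁻¹)) * deriv (evenQuantile μ) θ = π⁻¹ := by
  have hpi := Real.pi_pos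
  have hac : μ ≪ volume := by
    rw [hρ]
    exact withDensity_absolutelyContinuous _ _
  have hna : NullSingletonClass μ := ⟨fun x => hac (measure_singleton x)⟩
  have hm : AEMeasurable (quantile μ) (volume.restrict (Set.Ioo (0 : ℝ) 1)) :=
    aemeasurable_restrict_of_monotoneOn measurableSet_Ioo (monotoneOn_quantile μ)
  have h1 : ∀ᵐ x ∂(volume.restrict (Set.Ioo (0 : ℝ) 1)).map (quantile μ),
      HasDerivAt (cdf μ) (ρ x) x := by
    rw [map_quantile]
    exact hac.ae_le (ae_hasDerivAt_cdf hρ_meas hρ_nonneg hρ)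
  have h2 : ∀ᵐ u ∂(volume.restrict (Set.Ioo 0 π)).map (fun θ => θ * π⁻¹),
      HasDerivAt (cdf μ) (ρ (quantile μ u)) (quantile μ u) := by
    rw [map_mul_inv_pi_restrict]
    exact Measure.ae_smul_measure (ae_of_ae_map hm h1) _
  have h3 := ae_of_ae_map (by fun_prop) h2
  have h4 : ∀ᵐ θ ∂volume.restrict (Set.Ioo 0 π), DifferentiableAt ℝ (evenQuantile μ) θ :=
    ae_mono (Measure.restrict_mono (Set.Ioo_subset_Ioo_left (by linarith)) le_rfl) hQ.1
  have heq : ∀ θ ∈ Set.Ioo 0 π, evenQuantile μ θ = quantile μ (θ * π⁻¹) := fun θ hθ => by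
    rw [evenQuantile, abs_of_pos hθ.1, div_eq_mul_inv]
  have hmem : ∀ θ ∈ Set.Ioo 0 π, θ * π⁻¹ ∈ Set.Ioo (0 : ℝ) 1 := fun θ hθ => by
    rw [← div_eq_mul_inv]
    exact ⟨div_pos hθ.1 hpi, (div_lt_one hpi).2 hθ.2⟩
  filter_upwards [h3, h4, ae_restrict_mem measurableSet_Ioo] with θ hF hq hθ
  rw [← heq θ hθ] at hF ⊢
  have hcomp := hF.comp θ hq.hasDerivAt
  have hid : HasDerivAt (cdf μ ∘ evenQuantile μ) π⁻¹ θ := by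
    have h := (hasDerivAt_id θ).mul_const π⁻¹
    rw [one_mul] at h
    refine h.congr_of_eventuallyEq ?_
    filter_upwards [Ioo_mem_nhds hθ.1 hθ.2] with t ht
    rw [Function.comp, heq t ht, cdf_quantile μ (hmem t ht)]
    rfl
  exact hcomp.unique hid

lemma lintegral_deriv_evenQuantile {μ : Measure ℝ} [IsProbabilityMeasure μ] {ρ : ℝ → ℝ}
    (hρ_nonneg : ∀ x, 0 ≤ ρ x)
    (hq : ∀ᵐ θ ∂volume.restrict (Set.Ioo 0 π),
      ρ (quantile μ (θ * π⁻¹)) * deriv (evenQuantile μ) θ = π⁻¹) :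
    ∫⁻ t in Set.Ioo (-π) π, ENNReal.ofReal (|deriv (evenQuantile μ) t| ^ 2) =
      ENNReal.ofReal (2 / π) *
        ∫⁻ x in Set.Ioo (0 : ℝ) 1, 1 / ENNReal.ofReal (ρ (quantile μ x)) ^ 2 := by
  have hpi := Real.pi_pos
  set q' := deriv (evenQuantile μ) with hq'
  have hneg : ∫⁻ t in Set.Ioo (-π) 0, ENNReal.ofReal (|q' t| ^ 2) =
      ∫⁻ t in Set.Ioo 0 π, ENNReal.ofReal (|q' t| ^ 2) := by
    have h := (Measure.measurePreserving_neg (volume : Measure ℝ)).setLIntegral_comp_preimage_emb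
      (Homeomorph.neg ℝ).measurableEmbedding (fun t => ENNReal.ofReal (|q' t| ^ 2)) (Set.Ioo 0 π)
    rw [← h]
    simp only [Set.neg_preimage, Set.neg_Ioo, neg_zero]
    refine lintegral_congr fun t => ?_
    rw [hq', deriv_evenQuantile_neg, abs_neg]
  have hsplit : ∫⁻ t in Set.Ioo (-π) π, ENNReal.ofReal (|q' t| ^ 2) =
      2 * ∫⁻ t in Set.Ioo 0 π, ENNReal.ofReal (|q' t| ^ 2) := by
    rw [setLIntegral_congr Ioo_ae_eq_Ioc,
      ← Set.Ioc_union_Ioc_eq_Ioc (show -π ≤ 0 by linarith) hpi.le,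
      lintegral_union measurableSet_Ioc (Set.Ioc_disjoint_Ioc_of_le le_rfl),
      ← setLIntegral_congr Ioo_ae_eq_Ioc, ← setLIntegral_congr Ioo_ae_eq_Ioc, hneg, two_mul]
  have hval : ∫⁻ t in Set.Ioo 0 π, ENNReal.ofReal (|q' t| ^ 2) = ∫⁻ t in Set.Ioo 0 π,
      ENNReal.ofReal (1 / π ^ 2) * (1 / ENNReal.ofReal (ρ (quantile μ (t * π⁻¹))) ^ 2) := by
    refine lintegral_congr_ae ?_
    filter_upwards [hq] with t ht
    -- `ρ` does not vanish here, so no division by zero enters `1 / ρ²`.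
    have hρ0 : 0 < ρ (quantile μ (t * π⁻¹)) := by
      refine lt_of_le_of_ne (hρ_nonneg _) fun h => ?_
      rw [← h, zero_mul] at ht
      exact (inv_pos.2 hpi).ne ht
    rw [← ENNReal.ofReal_pow hρ0.le, ← ENNReal.ofReal_one,
      ← ENNReal.ofReal_div_of_pos (by positivity), ← ENNReal.ofReal_mul (by positivity)]
    congr 1
    rw [sq_abs, eq_div_of_mul_eq hρ0.ne' ((mul_comm _ _).trans ht)]
    field_simp
  have hscale : ∫⁻ t in Set.Ioo 0 π, 1 / ENNReal.ofReal (ρ (quantile μ (t * π⁻¹))) ^ 2 =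
      ENNReal.ofReal π *
        ∫⁻ x in Set.Ioo (0 : ℝ) 1, 1 / ENNReal.ofReal (ρ (quantile μ x)) ^ 2 := by
    rw [← smul_eq_mul, ← lintegral_smul_measure, ← map_mul_inv_pi_restrict]
    exact (MeasurableEmbedding.lintegral_map (μ := volume.restrict (Set.Ioo 0 π))
      (Homeomorph.mulRight₀ π⁻¹ (inv_ne_zero hpi.ne')).measurableEmbedding
      fun x => 1 / ENNReal.ofReal (ρ (quantile μ x)) ^ 2).symm
  rw [hsplit, hval, lintegral_const_mul' _ _ ENNReal.ofReal_ne_top, hscale, ← mul_assoc,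
    ← mul_assoc, ← ENNReal.ofReal_ofNat 2, ← ENNReal.ofReal_mul (by positivity),
    ← ENNReal.ofReal_mul (by positivity)]
  congr 2
  field_simp

lemma distributionEnergy_eq_lintegral_deriv {μ : Measure ℝ}
    (hQ : FourierTermwiseDeriv (evenQuantile μ))
    (hpos : ∀ᵐ t ∂volume.restrict (Set.Ioo 0 π), 0 < deriv (evenQuantile μ) t) :
    distributionEnergy μ = ENNReal.ofReal (1 / 2 * (1 / (2 * π))) *
      ∫⁻ t in Set.Ioo (-π) π, ENNReal.ofReal (|deriv (evenQuantile μ) t| ^ 2) := by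
  have huni := isUnivalentOnto_grossMap hQ hpos
  have henergy : ∀ f, IsUnivalentOnto f (grossDomain μ) →
      kineticEnergy (fun θ => (radialLimit f θ).re) =
        ENNReal.ofReal (1 / 2 * (1 / (2 * π))) * ∫⁻ t in Set.Ioo (-π) π,
          ENNReal.ofReal (|deriv (evenQuantile μ) t| ^ 2) := fun f hf => by
    obtain ⟨α, hα⟩ := huni.exists_rotation hf
    refine kineticEnergy_radialLimit hQ.2.2.1 (deriv_evenQuantile_neg μ) α fun z hz => ?_
    rw [hα z hz, grossMap_eq_logPotential hQ]
    rw [norm_mul_exp_ofReal_mul_I]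
    simpa using hz
  rw [distributionEnergy, domainEnergy]
  refine le_antisymm ?_ (le_iInf₂ fun f hf => (henergy f hf).ge)
  rw [← henergy _ huni]
  exact iInf₂_le (grossMap μ) huni

end Skorokhod

end

theorem theorem1p3 (μ : Measure ℝ) [IsProbabilityMeasure μ]
    (hsupp : Bornology.IsBounded μ.support)
    (hcentered : ∫ x, x ∂μ = 0)
    (ρ : ℝ → ℝ) (hρ_meas : Measurable ρ) (hρ_nonneg : ∀ x, 0 ≤ ρ x)
    (hρ : μ = volume.withDensity fun x => ENNReal.ofReal (ρ x))
    (hQ : Skorokhod.FourierTermwiseDeriv (Skorokhod.evenQuantile μ)) :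
    Skorokhod.distributionEnergy μ =
      ENNReal.ofReal (1 / (2 * π ^ 2)) *
        ∫⁻ x in Set.Ioo (0 : ℝ) 1, 1 / ENNReal.ofReal (ρ (Skorokhod.quantile μ x)) ^ 2 := by
  have hq := Skorokhod.ae_density_mul_deriv_evenQuantile hρ_meas hρ_nonneg hρ hQ
  have hpos : ∀ᵐ t ∂volume.restrict (Set.Ioo 0 π), 0 < deriv (Skorokhod.evenQuantile μ) t := by
    filter_upwards [hq] with t ht
    refine pos_of_mul_pos_right ?_ (hρ_nonneg (Skorokhod.quantile μ (t * π⁻¹)))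
    rw [ht]
    exact inv_pos.2 Real.pi_pos
  rw [Skorokhod.distributionEnergy_eq_lintegral_deriv hQ hpos,
    Skorokhod.lintegral_deriv_evenQuantile hρ_nonneg hq, ← mul_assoc,
    ← ENNReal.ofReal_mul (by positivity)]
  congr 2
  field_simp
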